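/- **Setting.** Fix sets of function symbols, predicate symbols, variables and labels, and an arity in $\mathbb N$ for every function and predicate symbol. Terms are built from variables and function symbols in the usual way. *Schemas* are built from $\mathtt{skip}$ and assignments $y:=f^{(l)}(\mathbf x)$ ($f$ a function symbol, $l$ a label, $\mathbf x$ a tuple of $\mathrm{arity}(f)$ variables) by sequencing, by $\mathtt{if}\ p^{(l)}(\mathbf x)\ \mathtt{then}\ T_1\ \mathtt{else}\ T_2$ and by $\mathtt{while}\ p^{(l)}(\mathbf x)\ \mathtt{do}\ T$ ($p$ a predicate symbol, $\mathbf x$ a tuple of $\mathrm{arity}(p)$ variables). Distinct occurrences of the same symbol in a schema are always assumed to carry distinct labels. **Paths.** $\Pi(S)$ is the following set of words whose letters are assignments and tests $(p^{(l)},Z)$, $Z\in\{\mathsf T,\mathsf F\}$: $\Pi(\mathtt{skip})$ contains only the empty word; an assignment gives the one-letter word; $\Pi(S_1S_2)=\Pi(S_1)\Pi(S_2)$; an *if* schema gives $(p^{(l)},\mathsf T)\,\Pi(T_1)\cup(p^{(l)},\mathsf F)\,\Pi(T_2)$; a *while* schema gives $\big((p^{(l)},\mathsf T)\,\Pi(T)\big)^*(p^{(l)},\mathsf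 F)$. A *path-segment* of $S$ is a factor of a word in $\Pi(S)$; a *terminal* path-segment is a suffix of such a word. For a word $\sigma$, let $\sigma[v]$ denote the term that is the value of the variable $v$ after executing the assignments of $\sigma$ symbolically, starting from the natural state $e$ in which every variable has itself as its value. **Semantics.** A *Herbrand interpretation* $i$ assigns a truth value to every predicate term $p(\mathbf t)$ ($\mathbf t$ a tuple of $\mathrm{arity}(p)$ terms), function symbols being interpreted by formation of terms. The execution of $S$ under $i$ from $e$ follows the unique maximal (finite or infinite) path of $S$ in which every test $(p^{(l)},Z)$, reached after a prefix $\sigma$ and referencing the variables $\mathbf x$, satisfies $i(p(\sigma[\mathbf x]))=Z$. It *terminates* if this path is finite, i.e. is a word $\sigma\in\Pi(S)$; the *final value* of $u$ is then $\sigma[u]$. **Special schemas.** $S$ is *free* if every prefix of a word of $\Pi(S)$ is a prefix of the path followed under some Herbrand interpretation. $S$ is *liberal* if along every path followed under a Herbrand interpretation any two different assignments (positions on the path) create different terms. $S$ is *special* if it is free and liberal, no predicate symbol occurs in it more than once, and whenever a function symbol $f$ occurs in both the true and the false part of an *if* predicate of $S$, an occurrence in the true part and an occurrence in the false part always assign to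 different variables. **The set $\mathrm{need}(u)$.** In what follows let each function symbol in $\sigma[v]$ keep the label of the assignment that created it. For labelled symbols of $S$ write $f^{(l)}\rightsquigarrow g^{(m)}$ ($g$ a function symbol) if for some path-segment $\sigma$ of $S$ and some variable $v$ the term $\sigma[v]$ has the form $g^{(m)}(t_1,\dots,t_n)$ in which some $t_k$ has outermost symbol $f^{(l)}$. Write $f^{(l)}\rightsquigarrow p^{(m)}$ ($p$ a predicate symbol) if for some path-segment $\sigma\,(p^{(m)},Z)$ of $S$ and some variable $v$ referenced by $p^{(m)}$ the term $\sigma[v]$ has outermost symbol $f^{(l)}$. For a variable $u$, $\mathrm{need}(u)$ is the least set of labelled symbols of $S$ such that: $f^{(l)}\in\mathrm{need}(u)$ whenever $\sigma[u]$ has outermost symbol $f^{(l)}$ for some terminal path-segment $\sigma$ of $S$; if $x\in\mathrm{need}(u)$ and $f^{(l)}\rightsquigarrow x$, then $f^{(l)}\in\mathrm{need}(u)$; if $x\in\mathrm{need}(u)$ lies in the true or false part of the *if* predicate $p^{(l)}$, or in the body of the *while* predicate $p^{(l)}$, then $p^{(l)}\in\mathrm{need}(u)$. **Couples.** A *$p(\mathbf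 t)u$-couple* for $S$ is a pair of Herbrand interpretations $i,j$ that differ at the predicate term $p(\mathbf t)$ and at no other predicate term, such that the executions of $S$ from $e$ under $i$ and under $j$ both terminate and give different final values of $u$. A *$pu$-couple* is a $p(\mathbf t)u$-couple for some $\mathbf t$. **Theorem 8.4.** Let $S$ be a special schema and $u$ a variable. 1. For every predicate $p^{(l)}\in\mathrm{need}(u)$ there is a $pu$-couple for $S$. 2. For every labelled function symbol $f^{(l)}\in\mathrm{need}(u)$, either there is a Herbrand interpretation under which $S$, executed from $e$, terminates with a final value of $u$ that contains the symbol $f$, or there are a predicate $p^{(m)}\in\mathrm{need}(u)$ and a tuple $\mathbf t$ of terms, some component of which contains $f$, such that there is a $p(\mathbf t)u$-couple for $S$. -/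

import Mathlib

open scoped Computability

namespace SchemaTheory

/-- Terms over function symbols `G` with arities `ar` and variables `V`. -/
inductive Term {G : Type*} (ar : G → ℕ) (V : Type*)
  | var (v : V) : Term ar V
  | app (g : G) (ts : Fin (ar g) → Term ar V) : Term ar V

/-- The symbol `f` occurs somewhere in the term. -/
def Term.Contains {G : Type*} {ar : G → ℕ} {V : Type*} (f : G) : Term ar V → Prop
  | .var _ => False
  | .app g ts => g = f ∨ ∃ k, (ts k).Contains f

/-- `t` is a `g`-term, i.e. its outermost symbol is `g`. -/
def Term.HeadedBy {G : Type*} {ar : G → ℕ} {V : Type*} (g : G) (t : Term ar V) : Prop :=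
  ∃ ts, t = .app g ts

/-- `t` is an `fg`-term, i.e. `t = g(t₁, …, tₙ)` with some `tₖ` an `f`-term. -/
def Term.HeadedByOver {G : Type*} {ar : G → ℕ} {V : Type*} (f g : G) (t : Term ar V) : Prop :=
  ∃ ts, t = .app g ts ∧ ∃ k, (ts k).HeadedBy f

section

/- Function symbols `F`, predicate symbols `P`, their arities, variables `V`, labels `L`. -/
variable {F P : Type*} (arF : F → ℕ) (arP : P → ℕ) (V L : Type*)

/-- Structured schemas; every occurrence of a symbol carries a label. -/
inductive Schema
  | skip : Schema
  /-- `y := f^(l)(x);` -/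
  | assign (y : V) (f : F) (l : L) (x : Fin (arF f) → V) : Schema
  | seq (S T : Schema) : Schema
  /-- `if p^(l)(x) then T₁ else T₂` -/
  | ite (p : P) (l : L) (x : Fin (arP p) → V) (T₁ T₂ : Schema) : Schema
  /-- `while p^(l)(x) do T` -/
  | loop (p : P) (l : L) (x : Fin (arP p) → V) (T : Schema) : Schema

/-- The letters of which paths consist: assignments, and tests `(p^(l), Z)` with outcome `Z`.
A test also records the variables that it references. -/
inductive Letter
  | assign (y : V) (f : F) (l : L) (x : Fin (arF f) → V) : Letter
  | test (p : P) (l : L) (x : Fin (arP p) → V) (Z : Bool) : Letter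

/-- Labelled symbols. -/
inductive LSym (F P L : Type*)
  | func (f : F) (l : L) : LSym F P L
  | pred (p : P) (l : L) : LSym F P L

/-- Predicate terms `p(t)` over the Herbrand domain. -/
abbrev PredTerm : Type _ := (p : P) × (Fin (arP p) → Term arF V)

/-- Herbrand interpretations. As every function symbol `f` is interpreted by
`(t₁, …, tₙ) ↦ f(t₁, …, tₙ)`, all the data is a truth value for each predicate term. -/
abbrev Herbrand : Type _ := PredTerm arF arP V → Bool

/-- Herbrand states. -/
abbrev State : Type _ := V → Term arF V

end

section

variable {F P : Type*} {arF : F → ℕ} {arP : P → ℕ} {V L : Type*}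

/-- The natural state `e`, with `e(v) = v`. -/
def natState : State arF V := Term.var

/-! ### Running a word of letters -/

/-- The effect of one letter on a state with values in `D`, when `f^(l)` is evaluated by `ev f l`.
Tests change nothing. -/
noncomputable def Letter.act {D : Type*} (ev : (f : F) → L → (Fin (arF f) → D) → D)
    (d : V → D) : Letter arF arP V L → V → D
  | .assign y f l x => open Classical in Function.update d y (ev f l (fun k => d (x k)))
  | .test _ _ _ _ => d

/-- The state reached from the Herbrand state `d` by the assignments along a word. -/
noncomputable def run (d : State arF V) (σ : List (Letter arF arP V L)) : State arF V :=
  σ.foldl (Letter.act (fun f _ ts => Term.app f ts)) d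

/-- The state reached from the natural state by the assignments along a word, where each function
symbol in a value keeps the label of the assignment that created it. -/
noncomputable def labelledRun (σ : List (Letter arF arP V L)) :
    State (fun g : F × L => arF g.1) V :=
  σ.foldl (Letter.act (fun f l ts => Term.app (f, l) ts)) Term.var

/-- The word `σ`, executed from the state `d`, agrees with the interpretation `i`:
each test along `σ` has the outcome that `i` gives to the predicate term defined there. -/
def Agrees (i : Herbrand arF arP V) (d : State arF V) (σ : List (Letter arF arP V L)) : Prop :=
  ∀ (σ' : List (Letter arF arP V L)) (p : P) (l : L) (x : Fin (arP p) → V) (X : Bool),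
    σ' ++ [Letter.test p l x X] <+: σ → i ⟨p, fun k => run d σ' (x k)⟩ = X

namespace Schema

/-! ### Occurrences of symbols -/

/-- The labelled function symbols of a schema, listed once per occurrence. -/
def funcOccs : Schema arF arP V L → List (F × L)
  | .skip => []
  | .assign _ f l _ => [(f, l)]
  | .seq S T => S.funcOccs ++ T.funcOccs
  | .ite _ _ _ T₁ T₂ => T₁.funcOccs ++ T₂.funcOccs
  | .loop _ _ _ T => T.funcOccs

/-- The labelled predicate symbols of a schema, listed once per occurrence. -/
def predOccs : Schema arF arP V L → List (P × L)
  | .skip => []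
  | .assign _ _ _ _ => []
  | .seq S T => S.predOccs ++ T.predOccs
  | .ite p l _ T₁ T₂ => (p, l) :: (T₁.predOccs ++ T₂.predOccs)
  | .loop p l _ T => (p, l) :: T.predOccs

/-- Distinct occurrences of a symbol have distinct labels. -/
def WellLabelled (S : Schema arF arP V L) : Prop :=
  S.funcOccs.Nodup ∧ S.predOccs.Nodup

/-- No predicate symbol occurs more than once. -/
def PredicateLinear (S : Schema arF arP V L) : Prop :=
  (S.predOccs.map Prod.fst).Nodup

/-- The labelled symbol occurs in the schema. -/
def HasSym (S : Schema arF arP V L) : LSym F P L → Prop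
  | .func f l => (f, l) ∈ S.funcOccs
  | .pred p l => (p, l) ∈ S.predOccs

/-- The schema contains an assignment `y := f^(l)(x);`. -/
def Assigns (f : F) (l : L) (y : V) : Schema arF arP V L → Prop
  | .skip => False
  | .assign y' f' l' _ => f' = f ∧ l' = l ∧ y' = y
  | .seq S T => S.Assigns f l y ∨ T.Assigns f l y
  | .ite _ _ _ T₁ T₂ => T₁.Assigns f l y ∨ T₂.Assigns f l y
  | .loop _ _ _ T => T.Assigns f l y

/-- `S.Controls p l Z s`: the labelled symbol `s` lies in the `Z`-part of the *if* predicate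
`p^(l)` of `S`, or `Z` is `true` and `s` lies in the body of the *while* predicate `p^(l)`. -/
def Controls (p : P) (l : L) (Z : Bool) (s : LSym F P L) : Schema arF arP V L → Prop
  | .skip => False
  | .assign _ _ _ _ => False
  | .seq S T => S.Controls p l Z s ∨ T.Controls p l Z s
  | .ite q m _ T₁ T₂ =>
      (q = p ∧ m = l ∧ (if Z then T₁ else T₂).HasSym s) ∨
        T₁.Controls p l Z s ∨ T₂.Controls p l Z s
  | .loop q m _ T => (q = p ∧ m = l ∧ Z = true ∧ T.HasSym s) ∨ T.Controls p l Z s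

/-! ### Paths -/

/-- The language of all terminating paths through a schema. -/
def paths : Schema arF arP V L → Language (Letter arF arP V L)
  | .skip => {[]}
  | .assign y f l x => {[.assign y f l x]}
  | .seq S T => S.paths * T.paths
  | .ite p l x T₁ T₂ => {[.test p l x true]} * T₁.paths + {[.test p l x false]} * T₂.paths
  | .loop p l x T => ({[.test p l x true]} * T.paths)∗ * {[.test p l x false]}

/-- `σ` is a finite beginning of a word in `S.paths`. -/
def Begins (S : Schema arF arP V L) (σ : List (Letter arF arP V L)) : Prop :=
  ∃ τ ∈ S.paths, σ <+: τ

def PathSegment (S : Schema arF arP V L) (σ : List (Letter arF arP V L)) : Prop :=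
  ∃ μ ν, μ ++ σ ++ ν ∈ S.paths

def TerminalSegment (S : Schema arF arP V L) (σ : List (Letter arF arP V L)) : Prop :=
  ∃ μ, μ ++ σ ∈ S.paths

/-- `σ` is a finite beginning of the (finite or infinite) path that `S` takes under the
interpretation `i` from the initial state `d`. -/
def Follows (S : Schema arF arP V L) (i : Herbrand arF arP V) (d : State arF V)
    (σ : List (Letter arF arP V L)) : Prop :=
  S.Begins σ ∧ Agrees i d σ

open Classical in
/-- The final state of `S` under `i` from the initial state `d`; it is `none` if the path taken is
infinite, i.e. if no terminating path agrees with `i`. At most one terminating path does, see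
`paths_unique`. -/
noncomputable def final (S : Schema arF arP V L) (i : Herbrand arF arP V) (d : State arF V) :
    Option (State arF V) :=
  if h : ∃ σ ∈ S.paths, Agrees i d σ then some (run d h.choose) else none

end Schema

/-! ### The final state is well defined -/

theorem run_append (d : State arF V) (σ τ : List (Letter arF arP V L)) :
    run d (σ ++ τ) = run (run d σ) τ := by
  simp [run]

theorem Agrees.left {i : Herbrand arF arP V} {d : State arF V} {σ τ : List (Letter arF arP V L)}
    (h : Agrees i d (σ ++ τ)) : Agrees i d σ :=
  fun σ' p l x X hσ => h σ' p l x X (hσ.trans (List.prefix_append _ _))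

theorem Agrees.right {i : Herbrand arF arP V} {d : State arF V} {σ τ : List (Letter arF arP V L)}
    (h : Agrees i d (σ ++ τ)) : Agrees i (run d σ) τ := by
  intro σ' p l x X hσ
  have := h (σ ++ σ') p l x X (by simpa using hσ)
  simpa [run_append] using this

theorem Agrees.head {i : Herbrand arF arP V} {d : State arF V} {τ : List (Letter arF arP V L)}
    {p : P} {l : L} {x : Fin (arP p) → V} {X : Bool}
    (h : Agrees i d (Letter.test p l x X :: τ)) : i ⟨p, fun k => d (x k)⟩ = X := by
  have := h [] p l x X (by simp)
  simpa [run] using this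

theorem Agrees.tail {i : Herbrand arF arP V} {d : State arF V} {τ : List (Letter arF arP V L)}
    {p : P} {l : L} {x : Fin (arP p) → V} {X : Bool}
    (h : Agrees i d (Letter.test p l x X :: τ)) : Agrees i d τ := by
  have := Agrees.right (σ := [Letter.test p l x X]) (τ := τ) h
  simpa [run, Letter.act] using this

theorem Schema.paths_unique (S : Schema arF arP V L) (i : Herbrand arF arP V) :
    ∀ (d : State arF V) (σ τ : List (Letter arF arP V L)), σ ∈ S.paths → τ ∈ S.paths →
      Agrees i d σ → Agrees i d τ → σ = τ := by
  induction S with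
  | skip =>
    intro d σ τ hσ hτ _ _
    exact (Set.mem_singleton_iff.1 hσ).trans (Set.mem_singleton_iff.1 hτ).symm
  | assign y f l x =>
    intro d σ τ hσ hτ _ _
    exact (Set.mem_singleton_iff.1 hσ).trans (Set.mem_singleton_iff.1 hτ).symm
  | seq S T ihS ihT =>
    intro d σ τ hσ hτ h₁ h₂
    obtain ⟨σ₁, hσ₁, σ₂, hσ₂, rfl⟩ := Language.mem_mul.1 hσ
    obtain ⟨τ₁, hτ₁, τ₂, hτ₂, rfl⟩ := Language.mem_mul.1 hτ
    obtain rfl := ihS d σ₁ τ₁ hσ₁ hτ₁ h₁.left h₂.left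
    rw [ihT _ σ₂ τ₂ hσ₂ hτ₂ h₁.right h₂.right]
  | ite p l x T₁ T₂ ih₁ ih₂ =>
    intro d σ τ hσ hτ h₁ h₂
    rcases (Language.mem_add _ _ _).1 hσ with hσ | hσ <;>
    rcases (Language.mem_add _ _ _).1 hτ with hτ | hτ <;>
    obtain ⟨a, ha, σ, hσ', rfl⟩ := Language.mem_mul.1 hσ <;>
    obtain ⟨b, hb, τ, hτ', rfl⟩ := Language.mem_mul.1 hτ <;>
    obtain rfl := Set.mem_singleton_iff.1 ha <;>
    obtain rfl := Set.mem_singleton_iff.1 hb <;>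
    simp only [List.singleton_append] at h₁ h₂ ⊢
    · rw [ih₁ d σ τ hσ' hτ' h₁.tail h₂.tail]
    · simpa using h₁.head.symm.trans h₂.head
    · simpa using h₁.head.symm.trans h₂.head
    · rw [ih₂ d σ τ hσ' hτ' h₁.tail h₂.tail]
  | loop p l x T ih =>
    intro d σ τ hσ hτ h₁ h₂
    obtain ⟨σ', hσ', a, ha, rfl⟩ := Language.mem_mul.1 hσ
    obtain ⟨τ', hτ', b, hb, rfl⟩ := Language.mem_mul.1 hτ
    obtain rfl := Set.mem_singleton_iff.1 ha
    obtain rfl := Set.mem_singleton_iff.1 hb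
    obtain ⟨A, rfl, hA⟩ := Language.mem_kstar.1 hσ'
    obtain ⟨B, rfl, hB⟩ := Language.mem_kstar.1 hτ'
    clear hσ hτ hσ' hτ' ha hb
    induction A generalizing B d with
    | nil =>
      cases B with
      | nil => rfl
      | cons b B =>
        obtain ⟨c, hc, b, hb, rfl⟩ := Language.mem_mul.1 (hB b (by simp))
        obtain rfl := Set.mem_singleton_iff.1 hc
        simp only [List.flatten_nil, List.nil_append, List.flatten_cons, List.cons_append] at h₁ h₂
        simpa using h₁.head.symm.trans h₂.head
    | cons a A ihA =>
      obtain ⟨c, hc, a, ha, rfl⟩ := Language.mem_mul.1 (hA a (by simp))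
      obtain rfl := Set.mem_singleton_iff.1 hc
      cases B with
      | nil =>
        simp only [List.flatten_nil, List.nil_append, List.flatten_cons, List.cons_append] at h₁ h₂
        simpa using h₁.head.symm.trans h₂.head
      | cons b B =>
        obtain ⟨c, hc, b, hb, rfl⟩ := Language.mem_mul.1 (hB b (by simp))
        obtain rfl := Set.mem_singleton_iff.1 hc
        simp only [List.nil_append, List.flatten_cons, List.cons_append, List.append_assoc]
          at h₁ h₂ ⊢
        have h₁' := h₁.tail
        have h₂' := h₂.tail
        obtain rfl := ih d a b ha hb h₁'.left h₂'.left
        rw [ihA (run d a) (fun y hy => hA y (List.mem_cons_of_mem _ hy)) h₁'.right B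
          (fun y hy => hB y (List.mem_cons_of_mem _ hy)) h₂'.right]

theorem Schema.final_eq_some_iff {S : Schema arF arP V L} {i : Herbrand arF arP V}
    {d d' : State arF V} :
    S.final i d = some d' ↔ ∃ σ ∈ S.paths, Agrees i d σ ∧ run d σ = d' := by
  unfold Schema.final
  split_ifs with h
  · constructor
    · intro h'
      exact ⟨h.choose, h.choose_spec.1, h.choose_spec.2, Option.some.inj h'⟩
    · rintro ⟨σ, hσ, hag, rfl⟩
      rw [S.paths_unique i d _ σ h.choose_spec.1 hσ h.choose_spec.2 hag]
  · constructor
    · intro h'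
      cases h'
    · rintro ⟨σ, hσ, hag, -⟩
      exact absurd ⟨σ, hσ, hag⟩ h

namespace Schema

/-! ### Free, liberal and special schemas -/

/-- Every path can be executed from the natural state under some Herbrand interpretation. -/
def Free (S : Schema arF arP V L) : Prop :=
  ∀ σ, S.Begins σ → ∃ i : Herbrand arF arP V, S.Follows i natState σ

/-- Two assignments along an executable path never create the same term. -/
def Liberal (S : Schema arF arP V L) : Prop :=
  ∀ (i : Herbrand arF arP V) (μ ν : List (Letter arF arP V L))
    (v : V) (f : F) (l : L) (a : Fin (arF f) → V) (w : V) (g : F) (m : L) (b : Fin (arF g) → V),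
    S.Follows i natState (μ ++ [.assign v f l a] ++ ν ++ [.assign w g m b]) →
    run natState (μ ++ [.assign v f l a]) v ≠
      run natState (μ ++ [.assign v f l a] ++ ν ++ [.assign w g m b]) w

/-- Special schemas. (`Controls` with `false` forces `p` to be an *if* predicate.) -/
structure Special (S : Schema arF arP V L) : Prop where
  predicateLinear : S.PredicateLinear
  free : S.Free
  liberal : S.Liberal
  parts : ∀ (p : P) (k : L) (f : F) (l m : L) (y z : V),
    S.Controls p k true (.func f l) → S.Controls p k false (.func f m) →
    S.Assigns f l y → S.Assigns f m z → y ≠ z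

/-! ### Data dependence and the set `need(u)` -/

/-- The value created by `f^(l)` is used by the labelled symbol `s` along some path-segment. -/
def DataDep (S : Schema arF arP V L) (f : F) (l : L) : LSym F P L → Prop
  | .func g m => ∃ σ, S.PathSegment σ ∧ ∃ v, (labelledRun σ v).HeadedByOver (f, l) (g, m)
  | .pred p m => ∃ σ x Z, S.PathSegment (σ ++ [.test p m x Z]) ∧
      ∃ k, (labelledRun σ (x k)).HeadedBy (f, l)

/-- The value created by `f^(l)` is the value of `u` at the end of some terminal path-segment. -/
def FinalDep (S : Schema arF arP V L) (f : F) (l : L) (u : V) : Prop :=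
  ∃ σ, S.TerminalSegment σ ∧ (labelledRun σ u).HeadedBy (f, l)

/-- Membership in `need(u)`, the least set of labelled symbols that contains the `f^(l)` on which
the final value of `u` depends and is closed under backward data dependence and control. -/
inductive Need (S : Schema arF arP V L) (u : V) : LSym F P L → Prop
  | final (f : F) (l : L) : S.FinalDep f l u → Need S u (.func f l)
  | data (f : F) (l : L) (s : LSym F P L) : Need S u s → S.DataDep f l s → Need S u (.func f l)
  | control (p : P) (l : L) (Z : Bool) (s : LSym F P L) :
      Need S u s → S.Controls p l Z s → Need S u (.pred p l)

/-! ### Couples -/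

/-- `{i, j}` is a `p(t)u`-couple for `S`: the interpretations differ at the predicate term `p(t)`
and nowhere else, and from the natural state both executions terminate, with different final
values of `u`. -/
def IsCouple (S : Schema arF arP V L) (p : P) (t : Fin (arP p) → Term arF V) (u : V)
    (i j : Herbrand arF arP V) : Prop :=
  i ⟨p, t⟩ ≠ j ⟨p, t⟩ ∧ (∀ a : PredTerm arF arP V, a ≠ ⟨p, t⟩ → i a = j a) ∧
    ∃ d d' : State arF V, S.final i natState = some d ∧ S.final j natState = some d' ∧ d u ≠ d' u

end Schema

end

end SchemaTheory

open SchemaTheory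

/-!
Fix a predicate `p` in `need(u)`, a path leading to a test of `p`, and the predicate term `c` tested
there. The claim proved is that there is a couple at *this* `c` (`Schema.Need.exists_isCouple`).
Suppose there is none. Then `c` has no influence on the final value of `u`: two completed executions
whose interpretations differ at most at `c` give the same final `u`
(`insensitive_of_forall_not_isCouple`). The proof follows the backward dependence analysis in rounds
(`Extend`, `NeedUpTo`), a round adding the function symbols whose values flow into the symbols found
so far, and the predicates controlling these. The property that `c` has no influence is carried from
round to round in the form `Insensitive S u c N`: two words that differ at most in the value of `c`,
and that reach the same program point after the same events in `N`, agree on all variables about to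
be used by `N`.

Two lemmas carry this step. `eq_of_insensitive` says that a difference in `y` at a program point from
which a shortest path leads to a use of `y` by `N` would arrive there. Tests of the symbols
in `Extend S u N` can be made to follow the path on both sides, because by freeness their predicate
terms are new; the other tests may go either way, for their parts do not assign to `y`. Both sides
always complete such a statement, since a free schema terminates under every interpretation with
finitely many true predicate terms (`exists_execution_of_finite`).
`Insensitive.outcomes_not_free` says that a predicate newly added in a round can never be reached
with both outcomes open, that is, with different arguments on the two sides or with `c` as its
predicate term on both. Otherwise one side could be sent through an assignment to some `y` that
flows into `N`, and the other side through the opposite part. The last assignments to `y` on the two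
sides would then create different terms, by liberality and the condition on function symbols common
to both parts, and by `eq_of_insensitive` this is impossible. Together these give
`Insensitive.extend`; and as `p` is reached with `c` as its predicate term, the second lemma also
excludes `p` from every round, whereas `p` lies in `need(u)`.

For a function symbol `f` in `need(u)`, follow the term created by an assignment of `f` along the data
dependences until it is contained in the final value of `u` or is referenced by a test of a
predicate in `need(u)` (`Schema.Need.exists_contains`). In the second case there is a couple at the
predicate term tested there, since the first part provides couples at every such predicate term.
-/

namespace SchemaTheory

variable {F P : Type*} {arF : F → ℕ} {arP : P → ℕ} {V L : Type*}

/-! ### Values of variables after a word -/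

/-- The letter assigns to the variable `y`. -/
def Letter.Writes (y : V) : Letter arF arP V L → Prop
  | .assign z _ _ _ => z = y
  | .test _ _ _ _ => False

/-- The labelled symbol that a letter carries. -/
def Letter.sym : Letter arF arP V L → LSym F P L
  | .assign _ f l _ => .func f l
  | .test p l _ _ => .pred p l

theorem foldl_act_of_not_writes {D : Type*} (ev : (f : F) → L → (Fin (arF f) → D) → D) (y : V) :
    ∀ (σ : List (Letter arF arP V L)) (d : V → D), (∀ a ∈ σ, ¬ a.Writes y) →
      σ.foldl (Letter.act ev) d y = d y
  | [], _, _ => rfl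
  | a :: σ, d, h => by
    rw [List.foldl_cons, foldl_act_of_not_writes ev y σ _ fun b hb => h b (by simp [hb])]
    have ha := h a (by simp)
    cases a with
    | assign z f l x =>
      classical exact Function.update_of_ne (fun e => ha e.symm) _ _
    | test p l x Z => rfl

theorem foldl_act_last_write {D : Type*} (ev : (f : F) → L → (Fin (arF f) → D) → D) (d : V → D)
    {y : V} {f : F} {l : L} {x : Fin (arF f) → V} {σ τ : List (Letter arF arP V L)}
    (h : ∀ a ∈ τ, ¬ a.Writes y) :
    (σ ++ Letter.assign y f l x :: τ).foldl (Letter.act ev) d y =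
      ev f l fun k => σ.foldl (Letter.act ev) d (x k) := by
  rw [List.foldl_append, List.foldl_cons, foldl_act_of_not_writes ev y τ _ h]
  simp [Letter.act]

theorem run_of_not_writes {d : State arF V} {σ : List (Letter arF arP V L)} {y : V}
    (h : ∀ a ∈ σ, ¬ a.Writes y) : run d σ y = d y :=
  foldl_act_of_not_writes _ y σ d h

theorem run_last_write {d : State arF V} {y : V} {f : F} {l : L} {x : Fin (arF f) → V}
    {σ τ : List (Letter arF arP V L)} (h : ∀ a ∈ τ, ¬ a.Writes y) :
    run d (σ ++ Letter.assign y f l x :: τ) y = .app f fun k => run d σ (x k) :=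
  foldl_act_last_write _ d h

theorem run_append_of_not_writes {d : State arF V} {σ τ : List (Letter arF arP V L)} {y : V}
    (h : ∀ a ∈ τ, ¬ a.Writes y) : run d (σ ++ τ) y = run d σ y := by
  rw [run_append, run_of_not_writes h]

theorem exists_last_write {y : V} {σ : List (Letter arF arP V L)} (h : ∃ a ∈ σ, a.Writes y) :
    ∃ (σ₁ : List (Letter arF arP V L)) (f : F) (l : L) (x : Fin (arF f) → V)
      (σ₂ : List (Letter arF arP V L)),
      σ = σ₁ ++ Letter.assign y f l x :: σ₂ ∧ ∀ a ∈ σ₂, ¬ a.Writes y := by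
  induction σ with
  | nil => simp at h
  | cons b σ ih =>
    by_cases hσ : ∃ a ∈ σ, a.Writes y
    · obtain ⟨σ₁, f, l, x, σ₂, rfl, h₂⟩ := ih hσ
      exact ⟨b :: σ₁, f, l, x, σ₂, rfl, h₂⟩
    · obtain ⟨a, ha, hw⟩ := h
      rcases List.mem_cons.1 ha with rfl | ha
      · cases a with
        | assign z f l x =>
          obtain rfl : z = y := hw
          exact ⟨[], f, l, x, σ, rfl, fun a ha hw => hσ ⟨a, ha, hw⟩⟩
        | test p l x Z => exact hw.elim
      · exact (hσ ⟨a, ha, hw⟩).elim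

/-- A variable holding a compound labelled term got it from its last assignment. -/
theorem labelledRun_eq_app {σ : List (Letter arF arP V L)} {v : V} {f : F} {l : L}
    {ts : Fin (arF f) → Term (fun g : F × L => arF g.1) V}
    (h : labelledRun σ v = .app (f, l) ts) :
    ∃ (σ₁ : List (Letter arF arP V L)) (x : Fin (arF f) → V) (σ₂ : List (Letter arF arP V L)),
      σ = σ₁ ++ Letter.assign v f l x :: σ₂ ∧ (∀ a ∈ σ₂, ¬ a.Writes v) ∧
        ts = fun k => labelledRun σ₁ (x k) := by
  by_cases hw : ∃ a ∈ σ, a.Writes v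
  · obtain ⟨σ₁, g, m, x, σ₂, rfl, h₂⟩ := exists_last_write hw
    rw [labelledRun, foldl_act_last_write _ _ h₂] at h
    have hg := (Term.app.inj h).1
    cases hg
    exact ⟨σ₁, x, σ₂, rfl, h₂, (eq_of_heq (Term.app.inj h).2).symm⟩
  · push Not at hw
    rw [labelledRun, foldl_act_of_not_writes _ _ _ _ hw] at h
    cases h

/-! ### The control flow of a schema -/

/-- `Emits X a B`: the first letter of an execution of the statement `X` can be `a`, after which
the statements `B` remain to be executed. -/
inductive Emits : Schema arF arP V L → Letter arF arP V L → List (Schema arF arP V L) → Prop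
  | assign (y : V) (f : F) (l : L) (x : Fin (arF f) → V) :
      Emits (.assign y f l x) (.assign y f l x) []
  | iteTrue (p : P) (l : L) (x : Fin (arP p) → V) (T₁ T₂ : Schema arF arP V L) :
      Emits (.ite p l x T₁ T₂) (.test p l x true) [T₁]
  | iteFalse (p : P) (l : L) (x : Fin (arP p) → V) (T₁ T₂ : Schema arF arP V L) :
      Emits (.ite p l x T₁ T₂) (.test p l x false) [T₂]
  | loopTrue (p : P) (l : L) (x : Fin (arP p) → V) (T : Schema arF arP V L) :
      Emits (.loop p l x T) (.test p l x true) [T, .loop p l x T]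
  | loopFalse (p : P) (l : L) (x : Fin (arP p) → V) (T : Schema arF arP V L) :
      Emits (.loop p l x T) (.test p l x false) []

/-- `Steps n K σ K'`: from a point of control at which the statements `K` remain to be executed,
`n` steps that read the word `σ` lead to a point at which `K'` remains. Such lists of pending
statements play the role of program points. -/
inductive Steps : ℕ → List (Schema arF arP V L) → List (Letter arF arP V L) →
    List (Schema arF arP V L) → Prop
  | refl (K : List (Schema arF arP V L)) : Steps 0 K [] K
  | skip {n : ℕ} {K K' : List (Schema arF arP V L)} {σ : List (Letter arF arP V L)} :
      Steps n K σ K' → Steps (n + 1) (.skip :: K) σ K'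
  | seq {n : ℕ} {A B : Schema arF arP V L} {K K' : List (Schema arF arP V L)}
      {σ : List (Letter arF arP V L)} :
      Steps n (A :: B :: K) σ K' → Steps (n + 1) (.seq A B :: K) σ K'
  | letter {n : ℕ} {X : Schema arF arP V L} {a : Letter arF arP V L}
      {B K K' : List (Schema arF arP V L)} {σ : List (Letter arF arP V L)} :
      Emits X a B → Steps n (B ++ K) σ K' → Steps (n + 1) (X :: K) (a :: σ) K'

section Steps

variable {n m : ℕ} {A B C K K' K'' : List (Schema arF arP V L)} {X Y : Schema arF arP V L}
  {a b : Letter arF arP V L} {σ τ : List (Letter arF arP V L)}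

theorem Steps.trans (h : Steps n K σ K') (h' : Steps m K' τ K'') :
    Steps (n + m) K (σ ++ τ) K'' := by
  induction h with
  | refl K => simpa using h'
  | skip _ ih => simpa [Nat.add_right_comm] using Steps.skip (ih h')
  | seq _ ih => simpa [Nat.add_right_comm] using Steps.seq (ih h')
  | letter e _ ih => simpa [Nat.add_right_comm] using Steps.letter e (ih h')

theorem Steps.append_stack (h : Steps n A σ A') (B : List (Schema arF arP V L)) :
    Steps n (A ++ B) σ (A' ++ B) := by
  induction h with
  | refl K => exact .refl _
  | skip _ ih => exact .skip ih
  | seq _ ih => exact .seq ih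
  | letter e _ ih => exact .letter e (by simpa using ih)

theorem Emits.steps (h : Emits X a B) : Steps 1 (X :: K) [a] (B ++ K) :=
  .letter h (.refl _)

/-- A run that starts with the statements `A ++ B` pending either stays within `A` or first
completes `A`. -/
theorem Steps.split_stack (h : Steps n (A ++ B) σ C) :
    (∃ A', C = A' ++ B ∧ Steps n A σ A') ∨
      ∃ n₁ n₂ σ₁ σ₂, n = n₁ + n₂ ∧ σ = σ₁ ++ σ₂ ∧ Steps n₁ A σ₁ [] ∧ Steps n₂ B σ₂ C := by
  generalize hK : A ++ B = K at h
  induction h generalizing A with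
  | refl K => exact .inl ⟨A, hK.symm, .refl A⟩
  | @skip n K K' σ h ih =>
    cases A with
    | nil => exact .inr ⟨0, n + 1, [], σ, by simp, rfl, .refl _, by
        obtain rfl : B = _ := hK
        exact .skip h⟩
    | cons X A =>
      obtain ⟨rfl, hA⟩ := List.cons.inj hK
      change A ++ B = _ at hA
      rcases ih hA with ⟨A', rfl, h'⟩ | ⟨n₁, n₂, σ₁, σ₂, rfl, rfl, h₁, h₂⟩
      · exact .inl ⟨A', rfl, .skip h'⟩
      · exact .inr ⟨n₁ + 1, n₂, σ₁, σ₂, by omega, rfl, .skip h₁, h₂⟩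
  | @seq n S T K K' σ h ih =>
    cases A with
    | nil => exact .inr ⟨0, n + 1, [], σ, by simp, rfl, .refl _, by
        obtain rfl : B = _ := hK
        exact .seq h⟩
    | cons X A =>
      obtain ⟨rfl, hA⟩ := List.cons.inj hK
      change A ++ B = _ at hA
      rcases ih (A := S :: T :: A) (by simp [hA]) with
        ⟨A', rfl, h'⟩ | ⟨n₁, n₂, σ₁, σ₂, rfl, rfl, h₁, h₂⟩
      · exact .inl ⟨A', rfl, .seq h'⟩
      · exact .inr ⟨n₁ + 1, n₂, σ₁, σ₂, by omega, rfl, .seq h₁, h₂⟩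
  | @letter n X a D K K' σ e h ih =>
    cases A with
    | nil => exact .inr ⟨0, n + 1, [], a :: σ, by simp, rfl, .refl _, by
        obtain rfl : B = _ := hK
        exact .letter e h⟩
    | cons Y A =>
      obtain ⟨rfl, hA⟩ := List.cons.inj hK
      change A ++ B = _ at hA
      rcases ih (A := D ++ A) (by simp [hA]) with
        ⟨A', rfl, h'⟩ | ⟨n₁, n₂, σ₁, σ₂, rfl, rfl, h₁, h₂⟩
      · exact .inl ⟨A', rfl, .letter e h'⟩
      · exact .inr ⟨n₁ + 1, n₂, a :: σ₁, σ₂, by omega, rfl, .letter e h₁, h₂⟩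

theorem Steps.split_letter (h : Steps n K (σ ++ a :: τ) C) :
    ∃ n₁ n₂ X K₁ B, n = n₁ + (n₂ + 1) ∧ Steps n₁ K σ (X :: K₁) ∧ Emits X a B ∧
      Steps n₂ (B ++ K₁) τ C := by
  generalize hw : σ ++ a :: τ = w at h
  induction h generalizing σ with
  | refl K => simp at hw
  | skip h ih =>
    obtain ⟨n₁, n₂, X, K₁, B, rfl, h₁, e, h₂⟩ := ih hw
    exact ⟨n₁ + 1, n₂, X, K₁, B, by omega, .skip h₁, e, h₂⟩
  | seq h ih =>
    obtain ⟨n₁, n₂, X, K₁, B, rfl, h₁, e, h₂⟩ := ih hw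
    exact ⟨n₁ + 1, n₂, X, K₁, B, by omega, .seq h₁, e, h₂⟩
  | @letter n X b D K K' w e h ih =>
    cases σ with
    | nil =>
      obtain ⟨rfl, rfl⟩ := List.cons.inj hw
      exact ⟨0, n, X, K, D, by omega, .refl _, e, h⟩
    | cons c σ =>
      obtain ⟨rfl, hσ⟩ := List.cons.inj hw
      obtain ⟨n₁, n₂, X, K₁, B, rfl, h₁, e', h₂⟩ := ih hσ
      exact ⟨n₁ + 1, n₂, X, K₁, B, by omega, .letter e h₁, e', h₂⟩

theorem Emits.cons_mem_paths (h : Emits X a B) (hσ : σ ∈ (B.map Schema.paths).prod) :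
    a :: σ ∈ X.paths := by
  cases h with
  | assign y f l x =>
    obtain rfl : σ = [] := by simpa using hσ
    rfl
  | iteTrue p l x T₁ T₂ =>
    exact .inl (Language.mem_mul.2 ⟨[.test p l x true], rfl, σ, by simpa using hσ, rfl⟩)
  | iteFalse p l x T₁ T₂ =>
    exact .inr (Language.mem_mul.2 ⟨[.test p l x false], rfl, σ, by simpa using hσ, rfl⟩)
  | loopTrue p l x T =>
    have h1 : Schema.paths (.loop p l x T) = {[.test p l x false]} +
        {[.test p l x true]} * (T.paths * Schema.paths (.loop p l x T)) := by
      simp only [Schema.paths]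
      nth_rewrite 1 [← Language.one_add_self_mul_kstar_eq_kstar]
      rw [add_mul, one_mul, mul_assoc, mul_assoc]
    rw [h1]
    exact .inr (Language.mem_mul.2 ⟨[.test p l x true], rfl, σ, by simpa using hσ, rfl⟩)
  | loopFalse p l x T =>
    obtain rfl : σ = [] := by simpa using hσ
    exact Language.mem_mul.2 ⟨[], Language.nil_mem_kstar _, [.test p l x false], rfl, rfl⟩

theorem Steps.append_mem_prod (h : Steps n K σ C) (hτ : τ ∈ (C.map Schema.paths).prod) :
    σ ++ τ ∈ (K.map Schema.paths).prod := by
  induction h with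
  | refl K => exact hτ
  | @skip n K K' σ h ih =>
    have : (Schema.skip : Schema arF arP V L).paths = 1 := rfl
    simpa [this] using ih hτ
  | seq h ih => simpa [Schema.paths, mul_assoc] using ih hτ
  | letter e h ih =>
    have h1 := ih hτ
    rw [List.map_append, List.prod_append] at h1
    obtain ⟨α, hα, β, hβ, hαβ⟩ := Language.mem_mul.1 h1
    rw [List.map_cons, List.prod_cons]
    exact Language.mem_mul.2 ⟨_, e.cons_mem_paths hα, β, hβ, by simp [hαβ]⟩

theorem Steps.mem_paths {S : Schema arF arP V L} (h : Steps n [S] σ []) : σ ∈ S.paths := by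
  simpa using h.append_mem_prod (τ := []) (by simp)

theorem exists_steps_of_mem_paths (S : Schema arF arP V L) (hσ : σ ∈ S.paths)
    (K : List (Schema arF arP V L)) : ∃ n, Steps n (S :: K) σ K := by
  induction S generalizing σ K with
  | skip =>
    obtain rfl : σ = [] := hσ
    exact ⟨1, .skip (.refl _)⟩
  | assign y f l x =>
    obtain rfl : σ = [_] := hσ
    exact ⟨1, (Emits.assign y f l x).steps⟩
  | seq A B ihA ihB =>
    obtain ⟨α, hα, β, hβ, rfl⟩ := Language.mem_mul.1 hσ
    obtain ⟨n, hn⟩ := ihA hα (B :: K)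
    obtain ⟨m, hm⟩ := ihB hβ K
    exact ⟨_, .seq (hn.trans hm)⟩
  | ite p l x T₁ T₂ ih₁ ih₂ =>
    rcases (Language.mem_add _ _ _).1 hσ with hσ | hσ <;>
    obtain ⟨α, hα, β, hβ, rfl⟩ := Language.mem_mul.1 hσ <;>
    obtain rfl := Set.mem_singleton_iff.1 hα
    · obtain ⟨m, hm⟩ := ih₁ hβ K
      exact ⟨_, .letter (.iteTrue p l x T₁ T₂) hm⟩
    · obtain ⟨m, hm⟩ := ih₂ hβ K
      exact ⟨_, .letter (.iteFalse p l x T₁ T₂) hm⟩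
  | loop p l x T ih =>
    obtain ⟨α, hα, β, hβ, rfl⟩ := Language.mem_mul.1 hσ
    obtain rfl := Set.mem_singleton_iff.1 hβ
    obtain ⟨W, rfl, hW⟩ := Language.mem_kstar.1 hα
    clear hσ hα hβ
    induction W with
    | nil => exact ⟨1, (Emits.loopFalse p l x T).steps⟩
    | cons w W ihW =>
      obtain ⟨c, hc, w, hw, rfl⟩ := Language.mem_mul.1 (hW w (by simp))
      obtain rfl := Set.mem_singleton_iff.1 hc
      obtain ⟨n, hn⟩ := ih hw (.loop p l x T :: K)
      obtain ⟨m, hm⟩ := ihW fun y hy => hW y (List.mem_cons_of_mem _ hy)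
      exact ⟨_, by simpa using Steps.letter (.loopTrue p l x T) (hn.trans hm)⟩

theorem Schema.paths_nonempty (S : Schema arF arP V L) : ∃ σ, σ ∈ S.paths := by
  induction S with
  | skip => exact ⟨[], rfl⟩
  | assign y f l x => exact ⟨_, rfl⟩
  | seq A B ihA ihB =>
    obtain ⟨α, hα⟩ := ihA
    obtain ⟨β, hβ⟩ := ihB
    exact ⟨_, Language.mem_mul.2 ⟨α, hα, β, hβ, rfl⟩⟩
  | ite p l x T₁ T₂ ih₁ ih₂ =>
    obtain ⟨α, hα⟩ := ih₁
    exact ⟨_, .inl (Language.mem_mul.2 ⟨_, rfl, α, hα, rfl⟩)⟩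
  | loop p l x T ih =>
    exact ⟨_, Language.mem_mul.2 ⟨[], Language.nil_mem_kstar _, _, rfl, rfl⟩⟩

theorem exists_steps_nil (K : List (Schema arF arP V L)) : ∃ n σ, Steps n K σ [] := by
  induction K with
  | nil => exact ⟨0, [], .refl _⟩
  | cons S K ih =>
    obtain ⟨n, σ, h⟩ := ih
    obtain ⟨τ, hτ⟩ := S.paths_nonempty
    obtain ⟨m, hm⟩ := exists_steps_of_mem_paths S hτ K
    exact ⟨_, _, hm.trans h⟩

theorem Steps.exists_mem_paths {S : Schema arF arP V L} (h : Steps n [S] σ C) :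
    ∃ τ, σ ++ τ ∈ S.paths := by
  obtain ⟨m, τ, hm⟩ := exists_steps_nil C
  exact ⟨τ, (h.trans hm).mem_paths⟩

theorem Steps.begins {S : Schema arF arP V L} (h : Steps n [S] σ C) : S.Begins σ := by
  obtain ⟨τ, hτ⟩ := h.exists_mem_paths
  exact ⟨_, hτ, List.prefix_append _ _⟩

end Steps

/-! ### Occurrences of statements and their continuations -/

/-- The occurrences of statements in `S`, each with the list of statements that remain to be
executed after it when `K` remains after `S`. -/
def Schema.subs : Schema arF arP V L → List (Schema arF arP V L) →
    List (Schema arF arP V L × List (Schema arF arP V L))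
  | .skip, K => [(.skip, K)]
  | .assign y f l x, K => [(.assign y f l x, K)]
  | .seq A B, K => (.seq A B, K) :: (A.subs (B :: K) ++ B.subs K)
  | .ite p l x T₁ T₂, K => (.ite p l x T₁ T₂, K) :: (T₁.subs K ++ T₂.subs K)
  | .loop p l x T, K => (.loop p l x T, K) :: T.subs (.loop p l x T :: K)

/-- The labelled symbol occurs in one of the pending statements. -/
def SymIn (K : List (Schema arF arP V L)) (s : LSym F P L) : Prop :=
  ∃ T ∈ K, T.HasSym s

section Occurrences

variable {n : ℕ} {A B C J K K' : List (Schema arF arP V L)} {S T X Y : Schema arF arP V L}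
  {a b : Letter arF arP V L} {σ τ : List (Letter arF arP V L)} {s : LSym F P L}

@[simp] theorem hasSym_skip : ¬ (Schema.skip : Schema arF arP V L).HasSym s := by
  cases s <;> simp [Schema.HasSym, Schema.funcOccs, Schema.predOccs]

@[simp] theorem hasSym_assign {y : V} {f : F} {l : L} {x : Fin (arF f) → V} :
    (Schema.assign y f l x : Schema arF arP V L).HasSym s ↔ s = .func f l := by
  cases s <;> simp [Schema.HasSym, Schema.funcOccs, Schema.predOccs]

@[simp] theorem hasSym_seq : (Schema.seq S T).HasSym s ↔ S.HasSym s ∨ T.HasSym s := by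
  cases s <;> simp [Schema.HasSym, Schema.funcOccs, Schema.predOccs]

@[simp] theorem hasSym_ite {p : P} {l : L} {x : Fin (arP p) → V} :
    (Schema.ite p l x S T).HasSym s ↔ s = .pred p l ∨ S.HasSym s ∨ T.HasSym s := by
  cases s <;> simp [Schema.HasSym, Schema.funcOccs, Schema.predOccs]

@[simp] theorem hasSym_loop {p : P} {l : L} {x : Fin (arP p) → V} :
    (Schema.loop p l x T).HasSym s ↔ s = .pred p l ∨ T.HasSym s := by
  cases s <;> simp [Schema.HasSym, Schema.funcOccs, Schema.predOccs]

theorem wellLabelled_seq (h : (Schema.seq S T).WellLabelled) :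
    S.WellLabelled ∧ T.WellLabelled ∧ ∀ s, S.HasSym s → ¬ T.HasSym s := by
  obtain ⟨hf, hp⟩ := h
  simp only [Schema.funcOccs, Schema.predOccs, List.nodup_append'] at hf hp
  refine ⟨⟨hf.1, hp.1⟩, ⟨hf.2.1, hp.2.1⟩, fun s h₁ h₂ => ?_⟩
  cases s with
  | func f l => exact hf.2.2 h₁ h₂
  | pred p l => exact hp.2.2 h₁ h₂

theorem wellLabelled_ite {p : P} {l : L} {x : Fin (arP p) → V}
    (h : (Schema.ite p l x S T).WellLabelled) :
    S.WellLabelled ∧ T.WellLabelled ∧ (∀ s, S.HasSym s → ¬ T.HasSym s) ∧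
      ¬ S.HasSym (.pred p l) ∧ ¬ T.HasSym (.pred p l) := by
  obtain ⟨hf, hp⟩ := h
  simp only [Schema.funcOccs, Schema.predOccs, List.nodup_append', List.nodup_cons,
    List.mem_append, not_or] at hf hp
  refine ⟨⟨hf.1, hp.2.1⟩, ⟨hf.2.1, hp.2.2.1⟩, fun s h₁ h₂ => ?_, hp.1.1, hp.1.2⟩
  cases s with
  | func f l => exact hf.2.2 h₁ h₂
  | pred p l => exact hp.2.2.2 h₁ h₂

theorem wellLabelled_loop {p : P} {l : L} {x : Fin (arP p) → V}
    (h : (Schema.loop p l x T).WellLabelled) : T.WellLabelled ∧ ¬ T.HasSym (.pred p l) := by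
  obtain ⟨hf, hp⟩ := h
  simp only [Schema.funcOccs, Schema.predOccs, List.nodup_cons] at hf hp
  exact ⟨⟨hf, hp.2⟩, hp.1⟩

theorem mem_subs_self (S : Schema arF arP V L) (K : List (Schema arF arP V L)) :
    (S, K) ∈ S.subs K := by
  cases S <;> simp [Schema.subs]

theorem mem_subs_trans (h : (X, K) ∈ S.subs J) (h' : (Y, K') ∈ X.subs K) :
    (Y, K') ∈ S.subs J := by
  induction S generalizing J with
  | skip =>
    obtain ⟨rfl, rfl⟩ : X = .skip ∧ K = J := by simpa [Schema.subs] using h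
    exact h'
  | assign y f l x =>
    obtain ⟨rfl, rfl⟩ : X = .assign y f l x ∧ K = J := by simpa [Schema.subs] using h
    exact h'
  | seq S T ihS ihT =>
    simp only [Schema.subs, List.mem_cons, Prod.mk.injEq, List.mem_append] at h
    rcases h with ⟨rfl, rfl⟩ | h | h
    · exact h'
    · exact List.mem_cons_of_mem _ (List.mem_append_left _ (ihS h))
    · exact List.mem_cons_of_mem _ (List.mem_append_right _ (ihT h))
  | ite p l x S T ihS ihT =>
    simp only [Schema.subs, List.mem_cons, Prod.mk.injEq, List.mem_append] at h
    rcases h with ⟨rfl, rfl⟩ | h | h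
    · exact h'
    · exact List.mem_cons_of_mem _ (List.mem_append_left _ (ihS h))
    · exact List.mem_cons_of_mem _ (List.mem_append_right _ (ihT h))
  | loop p l x T ih =>
    simp only [Schema.subs, List.mem_cons, Prod.mk.injEq] at h
    rcases h with ⟨rfl, rfl⟩ | h
    · exact h'
    · exact List.mem_cons_of_mem _ (ih h)

theorem hasSym_of_mem_subs (h : (X, K) ∈ S.subs J) (hs : X.HasSym s) : S.HasSym s := by
  induction S generalizing J with
  | skip =>
    obtain ⟨rfl, rfl⟩ : X = .skip ∧ K = J := by simpa [Schema.subs] using h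
    exact hs
  | assign y f l x =>
    obtain ⟨rfl, rfl⟩ : X = .assign y f l x ∧ K = J := by simpa [Schema.subs] using h
    exact hs
  | seq S T ihS ihT =>
    simp only [Schema.subs, List.mem_cons, Prod.mk.injEq, List.mem_append] at h
    rcases h with ⟨rfl, rfl⟩ | h | h
    · exact hs
    · exact hasSym_seq.2 (.inl (ihS h))
    · exact hasSym_seq.2 (.inr (ihT h))
  | ite p l x S T ihS ihT =>
    simp only [Schema.subs, List.mem_cons, Prod.mk.injEq, List.mem_append] at h
    rcases h with ⟨rfl, rfl⟩ | h | h
    · exact hs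
    · exact hasSym_ite.2 (.inr (.inl (ihS h)))
    · exact hasSym_ite.2 (.inr (.inr (ihT h)))
  | loop p l x T ih =>
    simp only [Schema.subs, List.mem_cons, Prod.mk.injEq] at h
    rcases h with ⟨rfl, rfl⟩ | h
    · exact hs
    · exact hasSym_loop.2 (.inr (ih h))

theorem wellLabelled_of_mem_subs (hS : S.WellLabelled) (h : (X, K) ∈ S.subs J) :
    X.WellLabelled := by
  induction S generalizing J with
  | skip =>
    obtain ⟨rfl, rfl⟩ : X = .skip ∧ K = J := by simpa [Schema.subs] using h
    exact hS
  | assign y f l x =>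
    obtain ⟨rfl, rfl⟩ : X = .assign y f l x ∧ K = J := by simpa [Schema.subs] using h
    exact hS
  | seq S T ihS ihT =>
    simp only [Schema.subs, List.mem_cons, Prod.mk.injEq, List.mem_append] at h
    rcases h with ⟨rfl, rfl⟩ | h | h
    · exact hS
    · exact ihS (wellLabelled_seq hS).1 h
    · exact ihT (wellLabelled_seq hS).2.1 h
  | ite p l x S T ihS ihT =>
    simp only [Schema.subs, List.mem_cons, Prod.mk.injEq, List.mem_append] at h
    rcases h with ⟨rfl, rfl⟩ | h | h
    · exact hS
    · exact ihS (wellLabelled_ite hS).1 h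
    · exact ihT (wellLabelled_ite hS).2.1 h
  | loop p l x T ih =>
    simp only [Schema.subs, List.mem_cons, Prod.mk.injEq] at h
    rcases h with ⟨rfl, rfl⟩ | h
    · exact hS
    · exact ih (wellLabelled_loop hS).1 h

theorem Emits.hasSym (h : Emits X a B) : X.HasSym a.sym := by
  cases h <;> simp [Letter.sym]

theorem Emits.hasSym_of_symIn (h : Emits X a B) (hs : SymIn B s) : X.HasSym s := by
  obtain ⟨T, hT, hs⟩ := hs
  cases h <;> simp at hT <;> aesop

/-- The symbol at the head of a pending list determines the whole list. -/
theorem eq_of_sym_eq (hS : S.WellLabelled) (h : (X, K) ∈ S.subs J) (h' : (Y, K') ∈ S.subs J)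
    (e : Emits X a A) (e' : Emits Y b B) (hab : a.sym = b.sym) : X = Y ∧ K = K' := by
  have hX := e.hasSym
  have hY := e'.hasSym
  rw [← hab] at hY
  induction S generalizing J with
  | skip =>
    obtain ⟨rfl, rfl⟩ : X = .skip ∧ K = J := by simpa [Schema.subs] using h
    cases e
  | assign y f l x =>
    obtain ⟨rfl, rfl⟩ : X = .assign y f l x ∧ K = J := by simpa [Schema.subs] using h
    obtain ⟨rfl, rfl⟩ : Y = .assign y f l x ∧ K' = K := by simpa [Schema.subs] using h'
    exact ⟨rfl, rfl⟩
  | seq S T ihS ihT =>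
    obtain ⟨hS₁, hS₂, hd⟩ := wellLabelled_seq hS
    simp only [Schema.subs, List.mem_cons, Prod.mk.injEq, List.mem_append] at h h'
    rcases h with ⟨rfl, rfl⟩ | h | h
    · cases e
    all_goals rcases h' with ⟨rfl, rfl⟩ | h' | h'
    · cases e'
    · exact ihS hS₁ h h'
    · exact (hd _ (hasSym_of_mem_subs h hX) (hasSym_of_mem_subs h' hY)).elim
    · cases e'
    · exact (hd _ (hasSym_of_mem_subs h' hY) (hasSym_of_mem_subs h hX)).elim
    · exact ihT hS₂ h h'
  | ite p l x S T ihS ihT =>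
    obtain ⟨hS₁, hS₂, hd, hp₁, hp₂⟩ := wellLabelled_ite hS
    have hhead : ∀ {c : Letter arF arP V L} {D : List (Schema arF arP V L)},
        Emits (.ite p l x S T) c D → c.sym = .pred p l := by
      intro c D ec
      cases ec <;> rfl
    simp only [Schema.subs, List.mem_cons, Prod.mk.injEq, List.mem_append] at h h'
    rcases h with ⟨rfl, rfl⟩ | h | h <;> rcases h' with ⟨rfl, rfl⟩ | h' | h'
    · exact ⟨rfl, rfl⟩
    · exact (hp₁ (hhead e ▸ hasSym_of_mem_subs h' hY)).elim
    · exact (hp₂ (hhead e ▸ hasSym_of_mem_subs h' hY)).elim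
    · exact (hp₁ (hhead e' ▸ hab ▸ hasSym_of_mem_subs h hX)).elim
    · exact ihS hS₁ h h'
    · exact (hd _ (hasSym_of_mem_subs h hX) (hasSym_of_mem_subs h' hY)).elim
    · exact (hp₂ (hhead e' ▸ hab ▸ hasSym_of_mem_subs h hX)).elim
    · exact (hd _ (hasSym_of_mem_subs h' hY) (hasSym_of_mem_subs h hX)).elim
    · exact ihT hS₂ h h'
  | loop p l x T ih =>
    obtain ⟨hS₁, hp₁⟩ := wellLabelled_loop hS
    have hhead : ∀ {c : Letter arF arP V L} {D : List (Schema arF arP V L)},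
        Emits (.loop p l x T) c D → c.sym = .pred p l := by
      intro c D ec
      cases ec <;> rfl
    simp only [Schema.subs, List.mem_cons, Prod.mk.injEq] at h h'
    rcases h with ⟨rfl, rfl⟩ | h <;> rcases h' with ⟨rfl, rfl⟩ | h'
    · exact ⟨rfl, rfl⟩
    · exact (hp₁ (hhead e ▸ hasSym_of_mem_subs h' hY)).elim
    · exact (hp₁ (hhead e' ▸ hab ▸ hasSym_of_mem_subs h hX)).elim
    · exact ih hS₁ h h'

theorem assigns_of_mem_subs {y : V} {f : F} {l : L} {x : Fin (arF f) → V}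
    (h : (.assign y f l x, K) ∈ S.subs J) : S.Assigns f l y := by
  induction S generalizing J with
  | skip => simp [Schema.subs] at h
  | assign y' f' l' x' =>
    simp only [Schema.subs, List.mem_singleton, Prod.mk.injEq, Schema.assign.injEq] at h
    exact ⟨h.1.2.1.symm, h.1.2.2.1.symm, h.1.1.symm⟩
  | seq S T ihS ihT =>
    simp only [Schema.subs, List.mem_cons, Prod.mk.injEq, List.mem_append, reduceCtorEq,
      false_and, false_or] at h
    exact h.imp ihS ihT
  | ite p l x S T ihS ihT =>
    simp only [Schema.subs, List.mem_cons, Prod.mk.injEq, List.mem_append, reduceCtorEq,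
      false_and, false_or] at h
    exact h.imp ihS ihT
  | loop p l x T ih =>
    simp only [Schema.subs, List.mem_cons, Prod.mk.injEq, reduceCtorEq,
      false_and, false_or] at h
    exact ih h

theorem exists_mem_subs_of_hasSym (hs : T.HasSym s) (J : List (Schema arF arP V L)) :
    ∃ X K a B, (X, K) ∈ T.subs J ∧ Emits X a B ∧ a.sym = s := by
  induction T generalizing J with
  | skip => simp at hs
  | assign y f l x =>
    obtain rfl := hasSym_assign.1 hs
    exact ⟨_, _, _, _, mem_subs_self _ J, .assign y f l x, rfl⟩
  | seq S T ihS ihT =>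
    rcases hasSym_seq.1 hs with h | h
    · obtain ⟨X, K, a, B, hm, he⟩ := ihS h (T :: J)
      exact ⟨X, K, a, B, by simp [Schema.subs, hm], he⟩
    · obtain ⟨X, K, a, B, hm, he⟩ := ihT h J
      exact ⟨X, K, a, B, by simp [Schema.subs, hm], he⟩
  | ite p l x S T ihS ihT =>
    rcases hasSym_ite.1 hs with rfl | h | h
    · exact ⟨_, _, _, _, mem_subs_self _ J, .iteTrue p l x S T, rfl⟩
    · obtain ⟨X, K, a, B, hm, he⟩ := ihS h J
      exact ⟨X, K, a, B, by simp [Schema.subs, hm], he⟩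
    · obtain ⟨X, K, a, B, hm, he⟩ := ihT h J
      exact ⟨X, K, a, B, by simp [Schema.subs, hm], he⟩
  | loop p l x T ih =>
    rcases hasSym_loop.1 hs with rfl | h
    · exact ⟨_, _, _, _, mem_subs_self _ J, .loopTrue p l x T, rfl⟩
    · obtain ⟨X, K, a, B, hm, he⟩ := ih h (.loop p l x T :: J)
      exact ⟨X, K, a, B, by simp [Schema.subs, hm], he⟩

/-- Every occurrence of a statement in `T` can be reached from the beginning of `T`. -/
theorem exists_steps_of_mem_subs (h : (X, K) ∈ T.subs J) : ∃ n σ, Steps n (T :: J) σ (X :: K) := by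
  induction T generalizing J with
  | skip =>
    obtain ⟨rfl, rfl⟩ : X = .skip ∧ K = J := by simpa [Schema.subs] using h
    exact ⟨0, [], .refl _⟩
  | assign y f l x =>
    obtain ⟨rfl, rfl⟩ : X = .assign y f l x ∧ K = J := by simpa [Schema.subs] using h
    exact ⟨0, [], .refl _⟩
  | seq S T ihS ihT =>
    simp only [Schema.subs, List.mem_cons, Prod.mk.injEq, List.mem_append] at h
    rcases h with ⟨rfl, rfl⟩ | h | h
    · exact ⟨0, [], .refl _⟩
    · obtain ⟨n, σ, h⟩ := ihS h
      exact ⟨_, _, .seq h⟩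
    · obtain ⟨n, σ, h⟩ := ihT h
      obtain ⟨τ, hτ⟩ := S.paths_nonempty
      obtain ⟨m, hm⟩ := exists_steps_of_mem_paths S hτ (T :: J)
      exact ⟨_, _, .seq (hm.trans h)⟩
  | ite p l x S T ihS ihT =>
    simp only [Schema.subs, List.mem_cons, Prod.mk.injEq, List.mem_append] at h
    rcases h with ⟨rfl, rfl⟩ | h | h
    · exact ⟨0, [], .refl _⟩
    · obtain ⟨n, σ, h⟩ := ihS h
      exact ⟨_, _, .letter (.iteTrue p l x S T) h⟩
    · obtain ⟨n, σ, h⟩ := ihT h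
      exact ⟨_, _, .letter (.iteFalse p l x S T) h⟩
  | loop p l x T ih =>
    simp only [Schema.subs, List.mem_cons, Prod.mk.injEq] at h
    rcases h with ⟨rfl, rfl⟩ | h
    · exact ⟨0, [], .refl _⟩
    · obtain ⟨n, σ, h⟩ := ih h
      exact ⟨_, _, .letter (.loopTrue p l x T) h⟩

theorem exists_steps_of_hasSym (hs : T.HasSym s) :
    ∃ n σ X K a B, Steps n [T] σ (X :: K) ∧ Emits X a B ∧ a.sym = s := by
  obtain ⟨X, K, a, B, hm, he⟩ := exists_mem_subs_of_hasSym hs []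
  obtain ⟨n, σ, h⟩ := exists_steps_of_mem_subs hm
  exact ⟨n, σ, X, K, a, B, h, he⟩

theorem Steps.symIn (h : Steps n K σ K') (hs : SymIn K' s) : SymIn K s := by
  induction h with
  | refl K => exact hs
  | skip h ih =>
    obtain ⟨T, hT, hs⟩ := ih hs
    exact ⟨T, List.mem_cons_of_mem _ hT, hs⟩
  | @seq n A B K K' σ h ih =>
    obtain ⟨T, hT, hs⟩ := ih hs
    simp only [List.mem_cons] at hT
    rcases hT with rfl | rfl | hT
    · exact ⟨_, List.mem_cons_self, hasSym_seq.2 (.inl hs)⟩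
    · exact ⟨_, List.mem_cons_self, hasSym_seq.2 (.inr hs)⟩
    · exact ⟨T, List.mem_cons_of_mem _ hT, hs⟩
  | letter e h ih =>
    obtain ⟨T, hT, hs⟩ := ih hs
    rcases List.mem_append.1 hT with hT | hT
    · exact ⟨_, List.mem_cons_self, e.hasSym_of_symIn ⟨T, hT, hs⟩⟩
    · exact ⟨T, List.mem_cons_of_mem _ hT, hs⟩

theorem Emits.symIn (h : Emits X a B) : SymIn (X :: K) a.sym :=
  ⟨X, List.mem_cons_self, h.hasSym⟩

theorem Steps.symIn_of_mem (h : Steps n K σ K') (ha : a ∈ σ) : SymIn K a.sym := by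
  obtain ⟨σ₁, σ₂, rfl⟩ := List.append_of_mem ha
  obtain ⟨n₁, n₂, X, K₁, B, -, h₁, e, -⟩ := h.split_letter
  exact h₁.symIn e.symIn

theorem symIn_singleton : SymIn [T] s ↔ T.HasSym s := by
  simp [SymIn]

theorem mem_subs_of_emits (e : Emits X a (A ++ T :: B)) (h : (X, K) ∈ S.subs J) :
    (T, B ++ K) ∈ S.subs J := by
  refine mem_subs_trans h ?_
  generalize hD : A ++ T :: B = D at e
  cases e with
  | assign y f l x => simp at hD
  | iteTrue p l x T₁ T₂ =>
    obtain ⟨rfl, rfl, rfl⟩ : A = [] ∧ T = T₁ ∧ B = [] := by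
      cases A <;> simp_all
    simp [Schema.subs, mem_subs_self]
  | iteFalse p l x T₁ T₂ =>
    obtain ⟨rfl, rfl, rfl⟩ : A = [] ∧ T = T₂ ∧ B = [] := by
      cases A <;> simp_all
    simp [Schema.subs, mem_subs_self]
  | loopTrue p l x T₁ =>
    cases A with
    | nil =>
      obtain ⟨rfl, rfl⟩ := List.cons.inj hD
      simp [Schema.subs, mem_subs_self]
    | cons A₀ A =>
      obtain ⟨rfl, rfl, rfl⟩ : A = [] ∧ T = .loop p l x T₁ ∧ B = [] := by
        cases A <;> simp_all
      simp [Schema.subs]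
  | loopFalse p l x T => simp at hD

/-- Pending lists consist of occurrences together with their continuations. -/
theorem Steps.mem_subs (h : Steps n [S] σ (A ++ X :: K)) : (X, K) ∈ S.subs [] := by
  suffices H : ∀ {n : ℕ} {K₁ K₂ : List (Schema arF arP V L)} {σ : List (Letter arF arP V L)},
      Steps n K₁ σ K₂ → (∀ A X K, K₁ = A ++ X :: K → (X, K) ∈ S.subs []) →
        ∀ A X K, K₂ = A ++ X :: K → (X, K) ∈ S.subs [] by
    refine H h (fun A X K hK => ?_) A X K rfl
    obtain ⟨rfl, rfl, rfl⟩ : A = [] ∧ S = X ∧ K = [] := by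
      cases A <;> simp_all
    exact mem_subs_self _ _
  intro n K₁ K₂ σ h hK
  induction h with
  | refl K => exact hK
  | @skip n K K' σ h ih => exact ih fun A X K e => hK (.skip :: A) X K (by simp [e])
  | @seq n S₁ S₂ K K' σ h ih =>
    refine ih fun A X K₃ e => ?_
    have h₀ := mem_subs_trans (hK [] _ _ rfl)
      (Y := S₁) (K' := S₂ :: K) (by simp [Schema.subs, mem_subs_self])
    have h₁ := mem_subs_trans (hK [] _ _ rfl)
      (Y := S₂) (K' := K) (by simp [Schema.subs, mem_subs_self])
    cases A with
    | nil =>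
      obtain ⟨rfl, rfl⟩ := List.cons.inj e
      exact h₀
    | cons A₀ A =>
      cases A with
      | nil =>
        obtain ⟨-, e⟩ := List.cons.inj e
        obtain ⟨rfl, rfl⟩ := List.cons.inj e
        exact h₁
      | cons A₁ A =>
        obtain ⟨-, e⟩ := List.cons.inj e
        obtain ⟨-, e⟩ := List.cons.inj e
        exact hK (.seq S₁ S₂ :: A) X K₃ (by simpa using e)
  | @letter n X₀ a B K K' σ e h ih =>
    refine ih fun A X K₃ hA => ?_
    rcases List.append_eq_append_iff.1 hA with ⟨D, rfl, hD⟩ | ⟨D, rfl, hD⟩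
    · exact hK (X₀ :: D) X K₃ (by simp [hD])
    · cases D with
      | nil => exact hK [X₀] X K₃ (by simpa using hD.symm)
      | cons D₀ D =>
        obtain ⟨rfl, rfl⟩ := List.cons.inj hD
        exact mem_subs_of_emits e (hK [] _ _ rfl)

/-- Two reachable program points with the same labelled symbol ahead coincide. -/
theorem Steps.head_unique {m : ℕ} (hS : S.WellLabelled) (h : Steps n [S] σ (X :: K))
    (h' : Steps m [S] τ (Y :: K')) (e : Emits X a A) (e' : Emits Y b B) (hab : a.sym = b.sym) :
    X = Y ∧ K = K' :=
  eq_of_sym_eq hS (Steps.mem_subs (A := []) h) (Steps.mem_subs (A := []) h') e e' hab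

theorem Emits.flip {p : P} {l : L} {x : Fin (arP p) → V} {Z : Bool}
    (h : Emits X (.test p l x Z) B) (Z' : Bool) : ∃ B', Emits X (.test p l x Z') B' := by
  cases h <;> cases Z'
  exacts [⟨_, .iteFalse p l x _ _⟩, ⟨_, .iteTrue p l x _ _⟩, ⟨_, .iteFalse p l x _ _⟩,
    ⟨_, .iteTrue p l x _ _⟩, ⟨_, .loopFalse p l x _⟩, ⟨_, .loopTrue p l x _⟩,
    ⟨_, .loopFalse p l x _⟩, ⟨_, .loopTrue p l x _⟩]

/-! ### Control dependence in terms of the control flow -/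

theorem controls_of_emits {p : P} {l : L} {x : Fin (arP p) → V} {Z : Bool}
    (h : (X, K) ∈ S.subs J) (e : Emits X (.test p l x Z) B) (hs : SymIn B s) :
    s = .pred p l ∨ S.Controls p l Z s := by
  obtain ⟨T, hT, hs⟩ := hs
  induction S generalizing J with
  | skip =>
    obtain ⟨rfl, rfl⟩ : X = .skip ∧ K = J := by simpa [Schema.subs] using h
    cases e
  | assign y f l x =>
    obtain ⟨rfl, rfl⟩ : X = .assign y f l x ∧ K = J := by simpa [Schema.subs] using h
    cases e
  | seq S T ihS ihT =>
    simp only [Schema.subs, List.mem_cons, Prod.mk.injEq, List.mem_append] at h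
    rcases h with ⟨rfl, rfl⟩ | h | h
    · cases e
    · exact (ihS h).imp_right .inl
    · exact (ihT h).imp_right .inr
  | ite q m y S T ihS ihT =>
    simp only [Schema.subs, List.mem_cons, Prod.mk.injEq, List.mem_append] at h
    rcases h with ⟨rfl, rfl⟩ | h | h
    · cases e with
      | iteTrue => exact .inr (.inl ⟨rfl, rfl, by simpa [List.mem_singleton.1 hT] using hs⟩)
      | iteFalse => exact .inr (.inl ⟨rfl, rfl, by simpa [List.mem_singleton.1 hT] using hs⟩)
    · exact (ihS h).imp_right fun h => .inr (.inl h)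
    · exact (ihT h).imp_right fun h => .inr (.inr h)
  | loop q m y T ih =>
    simp only [Schema.subs, List.mem_cons, Prod.mk.injEq] at h
    rcases h with ⟨rfl, rfl⟩ | h
    · cases e with
      | loopTrue =>
        simp only [List.mem_cons, List.not_mem_nil, or_false] at hT
        rcases hT with rfl | rfl
        · exact .inr (.inl ⟨rfl, rfl, rfl, hs⟩)
        · exact (hasSym_loop.1 hs).imp_right fun h => .inl ⟨rfl, rfl, rfl, h⟩
      | loopFalse => simp at hT
    · exact (ih h).imp_right .inr

theorem exists_emits_of_controls {p : P} {l : L} {Z : Bool} (h : S.Controls p l Z s)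
    (J : List (Schema arF arP V L)) :
    ∃ X K x T B, (X, K) ∈ S.subs J ∧ Emits X (.test p l x Z) (T :: B) ∧ T.HasSym s := by
  induction S generalizing J with
  | skip => exact h.elim
  | assign y f l x => exact h.elim
  | seq S T ihS ihT =>
    rcases h with h | h
    · obtain ⟨X, K, x, T', B, hm, he⟩ := ihS h (T :: J)
      exact ⟨X, K, x, T', B, by simp [Schema.subs, hm], he⟩
    · obtain ⟨X, K, x, T', B, hm, he⟩ := ihT h J
      exact ⟨X, K, x, T', B, by simp [Schema.subs, hm], he⟩
  | ite q m y S T ihS ihT =>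
    rcases h with ⟨rfl, rfl, h⟩ | h | h
    · cases Z with
      | true => exact ⟨_, _, _, S, [], mem_subs_self _ J, .iteTrue _ _ _ _ _, h⟩
      | false => exact ⟨_, _, _, T, [], mem_subs_self _ J, .iteFalse _ _ _ _ _, h⟩
    · obtain ⟨X, K, x, T', B, hm, he⟩ := ihS h J
      exact ⟨X, K, x, T', B, by simp [Schema.subs, hm], he⟩
    · obtain ⟨X, K, x, T', B, hm, he⟩ := ihT h J
      exact ⟨X, K, x, T', B, by simp [Schema.subs, hm], he⟩
  | loop q m y T ih =>
    rcases h with ⟨rfl, rfl, rfl, h⟩ | h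
    · exact ⟨_, _, _, T, _, mem_subs_self _ J, .loopTrue _ _ _ _, h⟩
    · obtain ⟨X, K, x, T', B, hm, he⟩ := ih h (.loop q m y T :: J)
      exact ⟨X, K, x, T', B, by simp [Schema.subs, hm], he⟩

theorem not_hasSym_of_emits {p : P} {l : L} {x : Fin (arP p) → V} {Z : Bool}
    (hX : X.WellLabelled) (e : Emits X (.test p l x Z) (T :: B)) : ¬ T.HasSym (.pred p l) := by
  cases e with
  | iteTrue => exact (wellLabelled_ite hX).2.2.2.1
  | iteFalse => exact (wellLabelled_ite hX).2.2.2.2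
  | loopTrue => exact (wellLabelled_loop hX).2

theorem controls_trans (hS : S.WellLabelled) {p q : P} {l m : L} {Z Z' : Bool}
    (h : S.Controls p l Z (.pred q m)) (h' : S.Controls q m Z' s) : S.Controls p l Z s := by
  obtain ⟨X, K, x, T, B, hm, e, hT⟩ := exists_emits_of_controls h []
  obtain ⟨Y, K', y, T', B', hm', e', hT'⟩ := exists_emits_of_controls h' []
  obtain ⟨Y', K'', b, D, hmY, eY, hb⟩ := exists_mem_subs_of_hasSym hT (B ++ K)
  have hmT : (T, B ++ K) ∈ S.subs [] := mem_subs_of_emits (A := []) e hm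
  obtain ⟨rfl, rfl⟩ := eq_of_sym_eq hS (mem_subs_trans hmT hmY) hm' eY e' hb
  have hTs : T.HasSym s :=
    hasSym_of_mem_subs hmY (e'.hasSym_of_symIn ⟨T', List.mem_cons_self, hT'⟩)
  refine (controls_of_emits hm e ⟨T, List.mem_cons_self, hTs⟩).resolve_left ?_
  rintro rfl
  exact not_hasSym_of_emits (wellLabelled_of_mem_subs hS hm) e hTs

end Occurrences

/-! ### Tests made and terms created along a word -/

/-- Along `δ`, executed from the natural state, `q^(m)` tests the predicate term `q(w)`. -/
def Tests (δ : List (Letter arF arP V L)) (q : P) (m : L) (w : Fin (arP q) → Term arF V) : Prop :=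
  ∃ σ₁ x Z σ₂, δ = σ₁ ++ Letter.test q m x Z :: σ₂ ∧ w = fun k => run natState σ₁ (x k)

/-- Along `δ`, executed from the natural state, `f^(l)` creates the term `f(t)`. -/
def Creates (δ : List (Letter arF arP V L)) (f : F) (l : L) (t : Fin (arF f) → Term arF V) :
    Prop :=
  ∃ σ₁ y x σ₂, δ = σ₁ ++ Letter.assign y f l x :: σ₂ ∧ t = fun k => run natState σ₁ (x k)

/-- Along `δ`, executed from the natural state, the predicate term `a` is tested. -/
def Tested (δ : List (Letter arF arP V L)) (a : PredTerm arF arP V) : Prop :=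
  ∃ m, Tests δ a.1 m a.2

section Events

variable {δ τ : List (Letter arF arP V L)} {q q' : P} {m m' : L} {w : Fin (arP q) → Term arF V}
  {f : F} {l : L} {t : Fin (arF f) → Term arF V} {b : Letter arF arP V L}

theorem Tests.append (h : Tests δ q m w) (τ : List (Letter arF arP V L)) :
    Tests (δ ++ τ) q m w := by
  obtain ⟨σ₁, x, Z, σ₂, rfl, hw⟩ := h
  exact ⟨σ₁, x, Z, σ₂ ++ τ, by simp, hw⟩

theorem Creates.append (h : Creates δ f l t) (τ : List (Letter arF arP V L)) :
    Creates (δ ++ τ) f l t := by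
  obtain ⟨σ₁, y, x, σ₂, rfl, ht⟩ := h
  exact ⟨σ₁, y, x, σ₂ ++ τ, by simp, ht⟩

theorem exists_eq_of_append_cons_eq_append {α : Type*} {a b c d : List α} {x : α}
    (h : a ++ b = c ++ x :: d) : (∃ e, a = c ++ x :: e) ∨ ∃ e, b = e ++ x :: d ∧ c = a ++ e := by
  rcases List.append_eq_append_iff.1 h with ⟨e, h₁, h₂⟩ | ⟨e, h₁, h₂⟩
  · exact .inr ⟨e, h₂, h₁⟩
  · cases e with
    | nil => exact .inr ⟨[], by simpa using h₂.symm, by simpa using h₁.symm⟩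
    | cons y e =>
      obtain ⟨rfl, -⟩ := List.cons.inj h₂
      exact .inl ⟨e, h₁⟩

theorem tests_append_iff (h : ∀ a ∈ τ, a.sym ≠ .pred q m) :
    Tests (δ ++ τ) q m w ↔ Tests δ q m w := by
  refine ⟨?_, fun h => h.append τ⟩
  rintro ⟨σ₁, x, Z, σ₂, e, hw⟩
  rcases exists_eq_of_append_cons_eq_append e with ⟨d, rfl⟩ | ⟨d, rfl, -⟩
  · exact ⟨σ₁, x, Z, d, rfl, hw⟩
  · exact (h (.test q m x Z) (by simp) rfl).elim

theorem creates_append_iff (h : ∀ a ∈ τ, a.sym ≠ .func f l) :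
    Creates (δ ++ τ) f l t ↔ Creates δ f l t := by
  refine ⟨?_, fun h => h.append τ⟩
  rintro ⟨σ₁, y, x, σ₂, e, ht⟩
  rcases exists_eq_of_append_cons_eq_append e with ⟨d, rfl⟩ | ⟨d, rfl, -⟩
  · exact ⟨σ₁, y, x, d, rfl, ht⟩
  · exact (h (.assign y f l x) (by simp) rfl).elim

theorem tests_snoc_iff {x : Fin (arP q) → V} {Z : Bool} :
    Tests (δ ++ [.test q m x Z]) q m w ↔
      Tests δ q m w ∨ w = fun k => run natState δ (x k) := by
  constructor
  · rintro ⟨σ₁, x', Z', σ₂, e, hw⟩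
    rcases exists_eq_of_append_cons_eq_append e with ⟨d, rfl⟩ | ⟨d, e', rfl⟩
    · exact .inl ⟨σ₁, x', Z', d, rfl, hw⟩
    · cases d with
      | nil =>
        obtain ⟨e', rfl⟩ := List.cons.inj e'
        cases e'
        exact .inr (by simpa using hw)
      | cons a d => simp at e'
  · rintro (h | rfl)
    · exact h.append _
    · exact ⟨δ, x, Z, [], rfl, rfl⟩

theorem creates_snoc_iff {y : V} {x : Fin (arF f) → V} :
    Creates (δ ++ [.assign y f l x]) f l t ↔
      Creates δ f l t ∨ t = fun k => run natState δ (x k) := by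
  constructor
  · rintro ⟨σ₁, y', x', σ₂, e, ht⟩
    rcases exists_eq_of_append_cons_eq_append e with ⟨d, rfl⟩ | ⟨d, e', rfl⟩
    · exact .inl ⟨σ₁, y', x', d, rfl, ht⟩
    · cases d with
      | nil =>
        obtain ⟨e', rfl⟩ := List.cons.inj e'
        cases e'
        exact .inr (by simpa using ht)
      | cons a d => simp at e'
  · rintro (h | rfl)
    · exact h.append _
    · exact ⟨δ, y, x, [], rfl, rfl⟩

end Events

section Agreement

variable {δ τ : List (Letter arF arP V L)} {i j : Herbrand arF arP V}

theorem agrees_iff {d : State arF V} : Agrees i d δ ↔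
    ∀ σ₁ p l x Z σ₂, δ = σ₁ ++ Letter.test p l x Z :: σ₂ →
      i ⟨p, fun k => run d σ₁ (x k)⟩ = Z := by
  constructor
  · rintro h σ₁ p l x Z σ₂ rfl
    exact h σ₁ p l x Z ⟨σ₂, by simp⟩
  · rintro h σ₁ p l x Z ⟨σ₂, rfl⟩
    exact h σ₁ p l x Z σ₂ (by simp)

theorem Agrees.congr (h : Agrees i natState δ) (hij : ∀ a, Tested δ a → i a = j a) :
    Agrees j natState δ := by
  rw [agrees_iff] at h ⊢
  intro σ₁ p l x Z σ₂ e
  rw [← h σ₁ p l x Z σ₂ e, hij _ ⟨l, σ₁, x, Z, σ₂, e, rfl⟩]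

theorem Agrees.snoc_test {d : State arF V} (h : Agrees i d δ) {q : P} {m : L}
    {x : Fin (arP q) → V} {Z : Bool} (hZ : i ⟨q, fun k => run d δ (x k)⟩ = Z) :
    Agrees i d (δ ++ [.test q m x Z]) := by
  rw [agrees_iff] at h ⊢
  intro σ₁ p l x' Z' σ₂ e
  rcases exists_eq_of_append_cons_eq_append e with ⟨c, rfl⟩ | ⟨c, e', rfl⟩
  · exact h _ _ _ _ _ _ rfl
  · cases c with
    | nil =>
      obtain ⟨e', rfl⟩ := List.cons.inj e'
      cases e'
      simpa using hZ
    | cons a c => simp at e'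

theorem Agrees.snoc_assign {d : State arF V} (h : Agrees i d δ) {f : F} {l : L} {y : V}
    {x : Fin (arF f) → V} : Agrees i d (δ ++ [.assign y f l x]) := by
  rw [agrees_iff] at h ⊢
  intro σ₁ p l x' Z' σ₂ e
  rcases exists_eq_of_append_cons_eq_append e with ⟨c, rfl⟩ | ⟨c, e', rfl⟩
  · exact h _ _ _ _ _ _ rfl
  · cases c with
    | nil => simp at e'
    | cons a c => simp at e'

end Agreement

/-! ### Consequences of freeness and liberality -/

section Free

variable {S X : Schema arF arP V L} {K B : List (Schema arF arP V L)} {n : ℕ}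
  {δ : List (Letter arF arP V L)}

/-- In a free schema no predicate term is tested twice along a path: otherwise the second outcome
could not be chosen freely. -/
theorem not_tested_of_free (hF : S.Free) (h : Steps n [S] δ (X :: K)) {q : P} {m : L}
    {x : Fin (arP q) → V} {Z : Bool} (e : Emits X (.test q m x Z) B) :
    ¬ Tested δ ⟨q, fun k => run natState δ (x k)⟩ := by
  rintro ⟨l, σ₁, x', Z', σ₂, hδ, hw⟩
  obtain ⟨B', e'⟩ := e.flip (!Z')
  obtain ⟨i, -, hi⟩ := hF _ (h.trans e'.steps).begins
  have h₁ := agrees_iff.1 hi σ₁ q l x' Z' (σ₂ ++ [.test q m x (!Z')]) (by rw [hδ]; simp)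
  have h₂ := agrees_iff.1 hi δ q m x (!Z') [] rfl
  rw [← hw, h₂] at h₁
  simp at h₁

/-- In a free liberal schema no term is created twice along a path. -/
theorem not_creates_of_liberal (hF : S.Free) (hL : S.Liberal) {y : V} {f : F} {l l' : L}
    {x : Fin (arF f) → V} (h : Steps n [S] δ (.assign y f l x :: K)) :
    ¬ Creates δ f l' fun k => run natState δ (x k) := by
  rintro ⟨σ₁, y', x', σ₂, hδ, ht⟩
  have hb := (h.trans (Emits.assign y f l x).steps).begins
  obtain ⟨i, hi⟩ := hF _ hb
  have hδ' : δ = σ₁ ++ [.assign y' f l' x'] ++ σ₂ := by simp [hδ]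
  have := hL i σ₁ σ₂ y' f l' x' y f l x (by rw [← hδ']; exact hi)
  apply this
  rw [← hδ', run_last_write (τ := []) (by simp), run_last_write (τ := []) (by simp)]
  exact congrArg _ ht.symm

end Free

/-! ### Termination under interpretations with finitely many true predicate terms -/

section Termination

variable {S : Schema arF arP V L} {i : Herbrand arF arP V}

/-- A free schema terminates under an interpretation with finitely many true predicate terms:
every iteration of a loop tests a true predicate term that was not tested before. -/
theorem exists_execution_of_finite (hF : S.Free) (hi : {a | i a = true}.Finite)
    (X : Schema arF arP V L) :
    ∀ {n : ℕ} {δ : List (Letter arF arP V L)} {K : List (Schema arF arP V L)},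
      Steps n [S] δ (X :: K) → Agrees i natState δ →
        ∃ m β, Steps m [X] β [] ∧ Agrees i natState (δ ++ β) := by
  induction X with
  | skip =>
    intro n δ K _ ha
    exact ⟨1, [], .skip (.refl _), by simpa using ha⟩
  | assign y f l x =>
    intro n δ K _ ha
    exact ⟨1, _, (Emits.assign y f l x).steps, ha.snoc_assign⟩
  | seq A B ihA ihB =>
    intro n δ K h ha
    have h₁ := h.trans (.seq (.refl _))
    rw [List.append_nil] at h₁
    obtain ⟨m, β, hβ, hβa⟩ := ihA h₁ ha
    obtain ⟨m', β', hβ', hβa'⟩ := ihB (h₁.trans (hβ.append_stack (B :: K))) hβa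
    refine ⟨_, β ++ β', .seq ((hβ.append_stack [B]).trans hβ'), by simpa using hβa'⟩
  | ite p l x T₁ T₂ ih₁ ih₂ =>
    intro n δ K h ha
    cases hZ : i ⟨p, fun k => run natState δ (x k)⟩ with
    | true =>
      obtain ⟨m, β, hβ, hβa⟩ := ih₁ (h.trans (Emits.iteTrue p l x T₁ T₂).steps) (ha.snoc_test hZ)
      exact ⟨_, _, .letter (.iteTrue p l x T₁ T₂) hβ, by simpa using hβa⟩
    | false =>
      obtain ⟨m, β, hβ, hβa⟩ := ih₂ (h.trans (Emits.iteFalse p l x T₁ T₂).steps) (ha.snoc_test hZ)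
      exact ⟨_, _, .letter (.iteFalse p l x T₁ T₂) hβ, by simpa using hβa⟩
  | loop p l x T ih =>
    -- each further iteration uses up one of the true predicate terms
    suffices H : ∀ (c : ℕ) {n : ℕ} {δ : List (Letter arF arP V L)}
        {K : List (Schema arF arP V L)}, {a | i a = true ∧ ¬ Tested δ a}.ncard ≤ c →
        Steps n [S] δ (.loop p l x T :: K) → Agrees i natState δ →
        ∃ m β, Steps m [Schema.loop p l x T] β [] ∧ Agrees i natState (δ ++ β) from
      fun {_ _ _} h ha => H _ le_rfl h ha
    intro c
    induction c with
    | zero =>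
      intro n δ K hc h ha
      cases hZ : i ⟨p, fun k => run natState δ (x k)⟩ with
      | true =>
        have hfin : {a | i a = true ∧ ¬ Tested δ a}.Finite := hi.subset fun a ha => ha.1
        have := (Set.ncard_eq_zero hfin).1 (Nat.le_zero.1 hc)
        exact absurd (show _ ∈ {a | i a = true ∧ ¬ Tested δ a} from
          ⟨hZ, not_tested_of_free hF h (Emits.loopTrue p l x T)⟩) (by simp [this])
      | false => exact ⟨_, _, (Emits.loopFalse p l x T).steps, ha.snoc_test hZ⟩
    | succ c ihc =>
      intro n δ K hc h ha
      cases hZ : i ⟨p, fun k => run natState δ (x k)⟩ with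
      | true =>
        obtain ⟨m, β, hβ, hβa⟩ := ih (h.trans (Emits.loopTrue p l x T).steps) (ha.snoc_test hZ)
        have h' := (h.trans (Emits.loopTrue p l x T).steps).trans
          (hβ.append_stack (.loop p l x T :: K))
        have hfin : {a | i a = true ∧ ¬ Tested δ a}.Finite := hi.subset fun a ha => ha.1
        have hlt : {a | i a = true ∧ ¬ Tested (δ ++ [.test p l x true] ++ β) a}.ncard <
            {a | i a = true ∧ ¬ Tested δ a}.ncard := by
          refine Set.ncard_lt_ncard ⟨?_, fun hsub => ?_⟩ hfin
          · rintro a ⟨h₁, h₂⟩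
            exact ⟨h₁, fun ⟨m, hm⟩ => h₂ ⟨m, (hm.append _).append _⟩⟩
          · exact (hsub ⟨hZ, not_tested_of_free hF h (Emits.loopTrue p l x T)⟩).2
              ⟨l, Tests.append (tests_snoc_iff.2 (.inr rfl)) _⟩
        obtain ⟨m', β', hβ', hβa'⟩ := ihc (by omega) h' hβa
        refine ⟨_, _, .letter (.loopTrue p l x T)
          ((hβ.append_stack [.loop p l x T]).trans hβ'), by simpa using hβa'⟩
      | false => exact ⟨_, _, (Emits.loopFalse p l x T).steps, ha.snoc_test hZ⟩

theorem exists_execution_stack_of_finite (hF : S.Free) (hi : {a | i a = true}.Finite)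
    (A : List (Schema arF arP V L)) {n : ℕ} {δ : List (Letter arF arP V L)}
    {K : List (Schema arF arP V L)} (h : Steps n [S] δ (A ++ K)) (ha : Agrees i natState δ) :
    ∃ m β, Steps m A β [] ∧ Agrees i natState (δ ++ β) := by
  induction A generalizing n δ with
  | nil => exact ⟨0, [], .refl _, by simpa using ha⟩
  | cons X A ih =>
    obtain ⟨m, β, hβ, hβa⟩ := exists_execution_of_finite hF hi X h ha
    obtain ⟨m', β', hβ', hβa'⟩ := ih (h.trans (hβ.append_stack (A ++ K))) hβa
    exact ⟨_, _, (hβ.append_stack A).trans hβ', by simpa using hβa'⟩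

end Termination

/-! ### Pairs of paths that differ in the value of one predicate term -/

/-- The words `δ` and `δ'` can be executed under two interpretations, with finitely many true
predicate terms, that agree except possibly at the predicate term `c`. -/
def Consistent (c : PredTerm arF arP V) (δ δ' : List (Letter arF arP V L)) : Prop :=
  ∃ i i' : Herbrand arF arP V, {a | i a = true}.Finite ∧ {a | i' a = true}.Finite ∧
    (∀ a, a ≠ c → i a = i' a) ∧ Agrees i natState δ ∧ Agrees i' natState δ'

section Consistent

variable {S : Schema arF arP V L} {c : PredTerm arF arP V} {δ δ' : List (Letter arF arP V L)}
  {q : P} {m : L} {x : Fin (arP q) → V} {Z Z' : Bool}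

theorem Consistent.symm (h : Consistent c δ δ') : Consistent c δ' δ := by
  obtain ⟨i, i', h₁, h₂, h₃, h₄, h₅⟩ := h
  exact ⟨i', i, h₂, h₁, fun a ha => (h₃ a ha).symm, h₅, h₄⟩

theorem Consistent.snoc_assign (h : Consistent c δ δ') (y : V) (f : F) (l : L)
    (x : Fin (arF f) → V) : Consistent c (δ ++ [.assign y f l x]) δ' := by
  obtain ⟨i, i', h₁, h₂, h₃, h₄, h₅⟩ := h
  exact ⟨i, i', h₁, h₂, h₃, h₄.snoc_assign, h₅⟩

/-- Pending statements can be run to their end on one side, without choosing any outcomes. -/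
theorem Consistent.exists_execution (hF : S.Free) (h : Consistent c δ δ')
    (A : List (Schema arF arP V L)) {n : ℕ} {K : List (Schema arF arP V L)}
    (hs : Steps n [S] δ (A ++ K)) : ∃ m β, Steps m A β [] ∧ Consistent c (δ ++ β) δ' := by
  obtain ⟨i, i', h₁, h₂, h₃, h₄, h₅⟩ := h
  obtain ⟨m, β, hβ, hβa⟩ := exists_execution_stack_of_finite hF h₁ A hs h₄
  exact ⟨m, β, hβ, i, i', h₁, h₂, h₃, hβa, h₅⟩

open Classical in
theorem finite_true_update {i : Herbrand arF arP V} (hi : {a | i a = true}.Finite)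
    (a : PredTerm arF arP V) (Z : Bool) : {b | Function.update i a Z b = true}.Finite := by
  refine (hi.insert a).subset fun b hb => ?_
  by_cases hba : b = a
  · exact .inl hba
  · exact .inr (by simpa [Function.update_of_ne hba] using hb)

open Classical in
/-- An outcome of a test can be chosen freely if its predicate term is new to both words. -/
theorem Consistent.snoc_test (h : Consistent c δ δ')
    (h₁ : ¬ Tested δ ⟨q, fun k => run natState δ (x k)⟩)
    (h₂ : ¬ Tested δ' ⟨q, fun k => run natState δ (x k)⟩) :
    Consistent c (δ ++ [.test q m x Z]) δ' := by
  obtain ⟨i, i', hi, hi', heq, ha, ha'⟩ := h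
  set a : PredTerm arF arP V := ⟨q, fun k => run natState δ (x k)⟩ with hadef
  refine ⟨Function.update i a Z, Function.update i' a Z, finite_true_update hi _ _,
    finite_true_update hi' _ _, fun b hb => ?_, ?_, ?_⟩
  · by_cases hba : b = a
    · simp [hba]
    · simp [Function.update_of_ne hba, heq b hb]
  · refine (ha.congr fun b hb => ?_).snoc_test (by simp [← hadef])
    rw [Function.update_of_ne]
    rintro rfl
    exact h₁ hb
  · refine ha'.congr fun b hb => ?_
    rw [Function.update_of_ne]
    rintro rfl
    exact h₂ hb

open Classical in
/-- The outcomes of two tests with new predicate terms can be chosen independently, unless these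
terms coincide and are not the exceptional one. -/
theorem Consistent.snoc_test_snoc_test (h : Consistent c δ δ')
    (h₁ : ¬ Tested δ ⟨q, fun k => run natState δ (x k)⟩)
    (h₂ : ¬ Tested δ' ⟨q, fun k => run natState δ (x k)⟩)
    (h₃ : ¬ Tested δ ⟨q, fun k => run natState δ' (x k)⟩)
    (h₄ : ¬ Tested δ' ⟨q, fun k => run natState δ' (x k)⟩)
    (hZ : Z = Z' ∨ (fun k => run natState δ (x k)) ≠ (fun k => run natState δ' (x k)) ∨
      (⟨q, fun k => run natState δ (x k)⟩ = c ∧ ⟨q, fun k => run natState δ' (x k)⟩ = c)) :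
    Consistent c (δ ++ [.test q m x Z]) (δ' ++ [.test q m x Z']) := by
  obtain ⟨i, i', hi, hi', heq, ha, ha'⟩ := h
  set a : PredTerm arF arP V := ⟨q, fun k => run natState δ (x k)⟩ with hadef
  set a' : PredTerm arF arP V := ⟨q, fun k => run natState δ' (x k)⟩ with hadef'
  by_cases hc : a = c ∧ a' = c
  · refine ⟨Function.update i a Z, Function.update i' a' Z', finite_true_update hi _ _,
      finite_true_update hi' _ _, fun b hb => ?_, ?_, ?_⟩
    · rw [Function.update_of_ne (by rw [hc.1]; exact hb),
        Function.update_of_ne (by rw [hc.2]; exact hb), heq b hb]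
    · refine (ha.congr fun b hb => ?_).snoc_test (by simp [← hadef])
      rw [Function.update_of_ne]
      rintro rfl
      exact h₁ hb
    · refine (ha'.congr fun b hb => ?_).snoc_test (by simp [← hadef'])
      rw [Function.update_of_ne]
      rintro rfl
      exact h₄ hb
  · have haa : Z = Z' ∨ a ≠ a' := by
      refine hZ.imp_right fun h => ?_
      rcases h with h | h
      · intro e
        exact h (eq_of_heq (Sigma.mk.inj e).2)
      · exact (hc h).elim
    have hval : Function.update (Function.update i a Z) a' Z' a = Z := by
      by_cases e : a = a'
      · rw [e, Function.update_self]
        exact (haa.resolve_right fun h => h e).symm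
      · rw [Function.update_of_ne e, Function.update_self]
    refine ⟨Function.update (Function.update i a Z) a' Z',
      Function.update (Function.update i' a Z) a' Z',
      finite_true_update (finite_true_update hi _ _) _ _,
      finite_true_update (finite_true_update hi' _ _) _ _, fun b hb => ?_, ?_, ?_⟩
    · by_cases h' : b = a'
      · simp [h']
      · by_cases h : b = a
        · rw [Function.update_of_ne h', Function.update_of_ne h', h, Function.update_self,
            Function.update_self]
        · simp [Function.update_of_ne h', Function.update_of_ne h, heq b hb]
    · refine (ha.congr fun b hb => ?_).snoc_test hval
      rw [Function.update_of_ne, Function.update_of_ne]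
      · rintro rfl
        exact h₁ hb
      · rintro rfl
        exact h₃ hb
    · refine (ha'.congr fun b hb => ?_).snoc_test (by simp [← hadef'])
      rw [Function.update_of_ne, Function.update_of_ne]
      · rintro rfl
        exact h₂ hb
      · rintro rfl
        exact h₄ hb

end Consistent

/-! ### Stages of the backward dependence analysis -/

/-- The letter references the variable `y`. -/
def Letter.Reads (y : V) : Letter arF arP V L → Prop
  | .assign _ _ _ x => ∃ k, x k = y
  | .test _ _ x _ => ∃ k, x k = y

/-- At the program point `C`, the value of `y` is about to be used: either by an assignment or
test whose symbol lies in `N`, or as the final value of `u`. -/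
def Uses (u : V) (N : LSym F P L → Prop) (y : V) : List (Schema arF arP V L) → Prop
  | [] => y = u
  | X :: _ => ∃ a B, Emits X a B ∧ N a.sym ∧ a.Reads y

/-- A value created by `f^(l)` can flow unchanged to a use by a symbol in `N`, or to the final
value of `u`. -/
def FlowsInto (S : Schema arF arP V L) (u : V) (N : LSym F P L → Prop) (f : F) (l : L) : Prop :=
  ∃ y x n σ m γ K C, Steps n [S] σ (.assign y f l x :: K) ∧ Steps m K γ C ∧
    (∀ a ∈ γ, ¬ a.Writes y) ∧ Uses u N y C

/-- One round of the dependence analysis: the symbols of `N`, the function symbols whose values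
flow into `N` or into `u`, and the predicates controlling them. -/
inductive Extend (S : Schema arF arP V L) (u : V) (N : LSym F P L → Prop) : LSym F P L → Prop
  | base {s : LSym F P L} : N s → Extend S u N s
  | flow {f : F} {l : L} : FlowsInto S u N f l → Extend S u N (.func f l)
  | control {p : P} {l : L} {Z : Bool} {s : LSym F P L} :
      Extend S u N s → S.Controls p l Z s → Extend S u N (.pred p l)

/-- The symbols found in the first `n` rounds of the dependence analysis. All rounds together
exhaust `need(u)`. -/
def NeedUpTo (S : Schema arF arP V L) (u : V) : ℕ → LSym F P L → Prop
  | 0 => fun _ => False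
  | n + 1 => Extend S u (NeedUpTo S u n)

/-- A set of labelled symbols that contains every predicate controlling one of its members. -/
def ControlClosed (S : Schema arF arP V L) (N : LSym F P L → Prop) : Prop :=
  ∀ p l Z s, N s → S.Controls p l Z s → N (.pred p l)

/-- The symbols of `N` create the same terms and test the same predicate terms along `δ` and
along `δ'`. -/
def SameEvents (N : LSym F P L → Prop) (δ δ' : List (Letter arF arP V L)) : Prop :=
  (∀ f l t, N (.func f l) → (Creates δ f l t ↔ Creates δ' f l t)) ∧
    ∀ q m w, N (.pred q m) → (Tests δ q m w ↔ Tests δ' q m w)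

/-- `c` has no influence through `N`: whenever two words that differ at most in the value of `c`
lead to the same program point after the same events in `N`, they agree on the variables that are
about to be used by `N`. -/
def Insensitive (S : Schema arF arP V L) (u : V) (c : PredTerm arF arP V)
    (N : LSym F P L → Prop) : Prop :=
  ∀ ⦃δ δ' : List (Letter arF arP V L)⦄ ⦃n n' : ℕ⦄ ⦃C : List (Schema arF arP V L)⦄ ⦃y : V⦄,
    Consistent c δ δ' → Steps n [S] δ C → Steps n' [S] δ' C → SameEvents N δ δ' → Uses u N y C →
      run natState δ y = run natState δ' y

section Analysis

variable {S X : Schema arF arP V L} {u y : V} {N N' : LSym F P L → Prop}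
  {c : PredTerm arF arP V} {δ δ' σ τ τ' γ β : List (Letter arF arP V L)}
  {A B C K K' : List (Schema arF arP V L)} {n n' m : ℕ} {s : LSym F P L}

theorem Uses.mono (h : ∀ s, N s → N' s) (hu : Uses u N y C) : Uses u N' y C := by
  cases C with
  | nil => exact hu
  | cons X K =>
    obtain ⟨a, B, e, hN, hr⟩ := hu
    exact ⟨a, B, e, h _ hN, hr⟩

theorem ControlClosed.extend : ControlClosed S (Extend S u N) :=
  fun _ _ _ _ hs hc => .control hs hc

theorem SameEvents.mono (h : ∀ s, N s → N' s) (hc : SameEvents N' δ δ') : SameEvents N δ δ' :=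
  ⟨fun f l t hN => hc.1 f l t (h _ hN), fun q m w hN => hc.2 q m w (h _ hN)⟩

theorem SameEvents.append (h : SameEvents N δ δ') (hτ : ∀ a ∈ τ, ¬ N a.sym)
    (hτ' : ∀ a ∈ τ', ¬ N a.sym) : SameEvents N (δ ++ τ) (δ' ++ τ') := by
  refine ⟨fun f l t hN => ?_, fun q m w hN => ?_⟩
  · rw [creates_append_iff fun a ha e => hτ a ha (e ▸ hN),
      creates_append_iff fun a ha e => hτ' a ha (e ▸ hN)]
    exact h.1 f l t hN
  · rw [tests_append_iff fun a ha e => hτ a ha (e ▸ hN),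
      tests_append_iff fun a ha e => hτ' a ha (e ▸ hN)]
    exact h.2 q m w hN

theorem Emits.test_args_eq {p : P} {l l' : L} {x x' : Fin (arP p) → V} {Z Z' : Bool}
    (h : Emits X (.test p l x Z) A) (h' : Emits X (.test p l' x' Z') B) : x = x' := by
  cases h <;> cases h' <;> rfl

/-- The symbols of a conditional statement other than its predicate lie in one of its parts. -/
theorem hasSym_cases {p : P} {l : L} {x : Fin (arP p) → V} {Z : Bool}
    (e : Emits X (.test p l x Z) B) (h : X.HasSym s) :
    s = .pred p l ∨ ∃ Z' B', Emits X (.test p l x Z') B' ∧ SymIn B' s := by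
  have ite_case : ∀ {T₁ T₂ : Schema arF arP V L}, (Schema.ite p l x T₁ T₂).HasSym s →
      s = .pred p l ∨ ∃ Z' B', Emits (.ite p l x T₁ T₂) (.test p l x Z') B' ∧ SymIn B' s := by
    intro T₁ T₂ h
    rcases hasSym_ite.1 h with h | h | h
    · exact .inl h
    · exact .inr ⟨_, _, .iteTrue p l x T₁ T₂, symIn_singleton.2 h⟩
    · exact .inr ⟨_, _, .iteFalse p l x T₁ T₂, symIn_singleton.2 h⟩
  have loop_case : ∀ {T : Schema arF arP V L}, (Schema.loop p l x T).HasSym s →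
      s = .pred p l ∨ ∃ Z' B', Emits (.loop p l x T) (.test p l x Z') B' ∧ SymIn B' s := by
    intro T h
    rcases hasSym_loop.1 h with h | h
    · exact .inl h
    · exact .inr ⟨_, _, .loopTrue p l x T, T, List.mem_cons_self, h⟩
  cases e with
  | iteTrue => exact ite_case h
  | iteFalse => exact ite_case h
  | loopTrue => exact loop_case h
  | loopFalse => exact loop_case h

theorem ControlClosed.pred_mem (hN : ControlClosed S N) (hX : (X, K) ∈ S.subs [])
    {p : P} {l : L} {x : Fin (arP p) → V} {Z : Bool} (e : Emits X (.test p l x Z) B)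
    (hs : X.HasSym s) (h : N s) : N (.pred p l) := by
  rcases hasSym_cases e hs with rfl | ⟨Z', B', e', hB'⟩
  · exact h
  · rcases controls_of_emits hX e' hB' with rfl | hc
    · exact h
    · exact hN _ _ _ _ h hc

/-- A path to a use by `N` leaves every list of statements that is free of symbols of `N`. -/
theorem Steps.leave (h : Steps n (A ++ K) σ C) (hA : ∀ s, SymIn A s → ¬ N s)
    (hu : Uses u N y C) : ∃ n₁ n₂ σ₁ σ₂, n = n₁ + n₂ ∧ σ = σ₁ ++ σ₂ ∧ Steps n₁ A σ₁ [] ∧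
      Steps n₂ K σ₂ C := by
  rcases h.split_stack with ⟨A', rfl, h'⟩ | h'
  · cases A' with
    | nil => exact ⟨n, 0, σ, [], by simp, by simp, h', .refl _⟩
    | cons Y A' =>
      obtain ⟨a, B, e, hN, -⟩ := hu
      exact (hA _ (h'.symIn e.symIn) hN).elim
  · exact h'

theorem Steps.pos_of_nil (h : Steps n (X :: A) σ []) : 0 < n := by
  cases h <;> omega

/-- If `y` is written on the way to a use of `y`, the last such assignment flows into that use. -/
theorem exists_flowsInto_of_writes (h : Steps n [S] δ A) (hβ : Steps m A β K)
    (hw : ∃ a ∈ β, a.Writes y) (hγ : Steps n' K γ C) (hy : ∀ a ∈ γ, ¬ a.Writes y)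
    (hu : Uses u N y C) : ∃ β₁ g k x β₂, β = β₁ ++ Letter.assign y g k x :: β₂ ∧
      (∀ a ∈ β₂, ¬ a.Writes y) ∧ FlowsInto S u N g k := by
  obtain ⟨β₁, g, k, x, β₂, rfl, hβ₂⟩ := exists_last_write hw
  obtain ⟨n₁, n₂, Y, K₁, B, -, h₁, e, h₂⟩ := hβ.split_letter
  cases e
  refine ⟨β₁, g, k, x, β₂, rfl, hβ₂, y, x, _, _, _, _, K₁, C, h.trans h₁, h₂.trans hγ, ?_, hu⟩
  intro a ha
  rcases List.mem_append.1 ha with ha | ha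
  · exact hβ₂ a ha
  · exact hy a ha

/-- Members of `Extend S u N` outside `N` come from a function symbol whose values flow into `N`. -/
theorem Extend.exists_flowsInto (hlab : S.WellLabelled) (hN : ControlClosed S N)
    (h : Extend S u N s) : N s ∨ ∃ f l, FlowsInto S u N f l ∧
      (s = .func f l ∨ ∃ p m Z, s = .pred p m ∧ S.Controls p m Z (.func f l)) := by
  induction h with
  | base h => exact .inl h
  | flow h => exact .inr ⟨_, _, h, .inl rfl⟩
  | @control p l Z s hs hc ih =>
    rcases ih with h | ⟨f, m, hf, rfl | ⟨q, k, Z', rfl, hc'⟩⟩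
    · exact .inl (hN _ _ _ _ h hc)
    · exact .inr ⟨f, m, hf, .inr ⟨p, l, Z, rfl, hc⟩⟩
    · exact .inr ⟨f, m, hf, .inr ⟨p, l, Z, rfl, controls_trans hlab hc hc'⟩⟩

theorem label_unique (hS : S.PredicateLinear) {q : P} {m m' : L} (h : S.HasSym (.pred q m))
    (h' : S.HasSym (.pred q m')) : m = m' :=
  congrArg Prod.snd (List.inj_on_of_nodup_map hS h h' rfl)

theorem Tests.hasSym (hδ : Steps n [S] δ C) {q : P} {m : L} {w : Fin (arP q) → Term arF V}
    (h : Tests δ q m w) : S.HasSym (.pred q m) := by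
  obtain ⟨σ₁, x, Z, σ₂, rfl, -⟩ := h
  exact symIn_singleton.1 (hδ.symIn_of_mem (a := .test q m x Z) (by simp))

/-- A predicate term about to be tested at the end of `δ` is new to every word `δ'` along which
the predicate has been applied to no other terms than along `δ`. -/
theorem not_tested_of_subset (hS : S.Special) (h : Steps n [S] δ (X :: K)) {q : P} {m : L}
    {x : Fin (arP q) → V} {Z : Bool} (e : Emits X (.test q m x Z) B) (h' : Steps n' [S] δ' C)
    (hsub : ∀ w, Tests δ' q m w → Tests δ q m w) :
    ¬ Tested δ' ⟨q, fun k => run natState δ (x k)⟩ := by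
  rintro ⟨m', ht⟩
  obtain rfl := label_unique hS.predicateLinear (ht.hasSym h')
    (symIn_singleton.1 (h.symIn e.symIn))
  exact not_tested_of_free hS.free h e ⟨_, hsub _ ht⟩

/-- No labelled predicate symbol is tested twice along the word. -/
def TestsOnce (γ : List (Letter arF arP V L)) : Prop :=
  ∀ σ₁ q m x Z σ₂, γ = σ₁ ++ Letter.test q m x Z :: σ₂ → ∀ a ∈ σ₂, a.sym ≠ .pred q m

theorem TestsOnce.of_append (h : TestsOnce (σ ++ γ)) : TestsOnce γ := by
  rintro σ₁ q m x Z σ₂ rfl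
  exact h (σ ++ σ₁) q m x Z σ₂ (by simp)

/-- A path of minimal length between two program points on which `y` is not written. -/
def IsShortest (y : V) (n : ℕ) (K : List (Schema arF arP V L)) (γ : List (Letter arF arP V L))
    (C : List (Schema arF arP V L)) : Prop :=
  Steps n K γ C ∧ (∀ a ∈ γ, ¬ a.Writes y) ∧
    ∀ m σ, Steps m K σ C → (∀ a ∈ σ, ¬ a.Writes y) → n ≤ m

theorem exists_isShortest (h : Steps n K γ C) (hy : ∀ a ∈ γ, ¬ a.Writes y) :
    ∃ m σ, IsShortest y m K σ C := by
  classical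
  have hex : ∃ m, ∃ σ, Steps m K σ C ∧ ∀ a ∈ σ, ¬ a.Writes y := ⟨n, γ, h, hy⟩
  obtain ⟨σ, h₁, h₂⟩ := Nat.find_spec hex
  exact ⟨_, σ, h₁, h₂, fun m σ hm hσ => Nat.find_min' hex ⟨σ, hm, hσ⟩⟩

theorem IsShortest.testsOnce (hlab : S.WellLabelled) (hK : Steps m [S] δ K)
    (h : IsShortest y n K γ C) : TestsOnce γ := by
  rintro σ₁ q k x Z σ₂ rfl a ha hsym
  obtain ⟨α, β, rfl⟩ := List.append_of_mem ha
  obtain ⟨h₁, hy, hmin⟩ := h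
  obtain ⟨n₁, n₂, X₁, K₁, B₁, rfl, s₁, e₁, s₂⟩ := h₁.split_letter
  obtain ⟨n₃, n₄, X₂, K₂, B₂, rfl, s₃, e₂, s₄⟩ := s₂.split_letter
  obtain ⟨rfl, rfl⟩ := (hK.trans s₁).head_unique hlab
    (((hK.trans s₁).trans e₁.steps).trans s₃) e₁ e₂ hsym.symm
  have := hmin _ _ (s₁.trans (.letter e₂ s₄)) fun b hb => hy b (by
    simp only [List.mem_append, List.mem_cons] at hb ⊢
    tauto)
  omega

/-- A shortest path from the exit of a statement to a use by `N` does not enter that statement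
again, unless the statement contains a symbol of `N`. -/
theorem IsShortest.not_hasSym (hlab : S.WellLabelled) (hK : Steps m [S] δ (X :: K))
    (hex : Steps n' [X] β [])
    (h : IsShortest y n K γ C) (hX : ∀ s, X.HasSym s → ¬ N s) (hu : Uses u N y C) :
    ∀ a ∈ γ, ¬ X.HasSym a.sym := by
  intro a ha hsym
  obtain ⟨σ₁, σ₂, rfl⟩ := List.append_of_mem ha
  obtain ⟨h₁, hy, hmin⟩ := h
  obtain ⟨n₁, n₂, X₁, K₁, B₁, rfl, s₁, e₁, s₂⟩ := h₁.split_letter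
  obtain ⟨k, ρ, Y, A, b, D, s₃, e₂, hb⟩ := exists_steps_of_hasSym hsym
  obtain ⟨rfl, rfl⟩ := (hK.trans (s₃.append_stack K)).head_unique hlab
    ((hK.trans (hex.append_stack K)).trans s₁) e₂ e₁ hb
  obtain ⟨n₃, n₄, τ₁, τ₂, hn, hτ, s₄, s₅⟩ := (Steps.letter e₁ s₂).leave (A := Y :: A)
    (fun s hs => hX s (symIn_singleton.1 (s₃.symIn hs))) hu
  have := hmin _ _ s₅ fun b hb => hy b (List.mem_append_right _ (by rw [hτ]; simp [hb]))
  have := s₄.pos_of_nil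
  omega

/-- Values that differ in `y` would be carried along `γ` to a use of `y` by `N`. Tests of
predicates relevant to `N` can be made to follow `γ` on both sides; other tests can go either way
without affecting `y`. -/
theorem eq_of_insensitive (hS : S.Special)
    (hins : Insensitive S u c N) (r : ℕ) :
    ∀ {δ δ' γ : List (Letter arF arP V L)} {K : List (Schema arF arP V L)} {n n' : ℕ},
      Consistent c δ δ' → Steps n [S] δ K → Steps n' [S] δ' K → Steps r K γ C →
      (∀ a ∈ γ, ¬ a.Writes y) → Uses u N y C → SameEvents N δ δ' → TestsOnce γ →
      (∀ q m, Extend S u N (.pred q m) → (∃ a ∈ γ, a.sym = .pred q m) →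
        ∀ w, Tests δ q m w ↔ Tests δ' q m w) →
      run natState δ y = run natState δ' y := by
  induction r using Nat.strong_induction_on with
  | _ r ih =>
  intro δ δ' γ K n n' hc h h' hγ hy hu hev honce htests
  cases hγ with
  | refl => exact hins hc h h' hev hu
  | @skip r K C γ hγ =>
    exact ih r (by omega) hc (by simpa using h.trans (.skip (.refl K)))
      (by simpa using h'.trans (.skip (.refl K))) hγ hy hu hev honce htests
  | @seq r T₁ T₂ K C γ hγ =>
    exact ih r (by omega) hc (by simpa using h.trans (.seq (.refl (T₁ :: T₂ :: K))))
      (by simpa using h'.trans (.seq (.refl (T₁ :: T₂ :: K)))) hγ hy hu hev honce htests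
  | @letter r X a B K C γ e hγ =>
    have honce' : TestsOnce γ := TestsOnce.of_append (σ := [a]) honce
    have hy' : ∀ a ∈ γ, ¬ a.Writes y := fun b hb => hy b (List.mem_cons_of_mem _ hb)
    have hya : ∀ b ∈ [a], ¬ b.Writes y := fun b hb => hy b (by simp_all)
    rw [← run_append_of_not_writes (τ := [a]) hya, ← run_append_of_not_writes (σ := δ') hya]
    -- the arguments of a symbol in `N` have the same values on both sides
    have hargs : N a.sym → ∀ z, a.Reads z → run natState δ z = run natState δ' z :=
      fun hNa z hz => hins hc h h' hev ⟨a, B, e, hNa, hz⟩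
    cases a with
    | assign z g k x =>
      refine ih r (by omega) ((hc.snoc_assign z g k x).symm.snoc_assign z g k x).symm (h.trans e.steps)
        (h'.trans e.steps) hγ hy' hu ⟨fun f l t hf => ?_, fun q m w hq => ?_⟩ honce' ?_
      · by_cases hfg : LSym.func g k = (LSym.func f l : LSym F P L)
        · cases hfg
          have : (fun j => run natState δ (x j)) = fun j => run natState δ' (x j) :=
            funext fun j => hargs hf _ ⟨j, rfl⟩
          rw [creates_snoc_iff, creates_snoc_iff, hev.1 _ _ _ hf, this]
        · rw [creates_append_iff (by simpa [Letter.sym] using hfg),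
            creates_append_iff (by simpa [Letter.sym] using hfg)]
          exact hev.1 _ _ _ hf
      · rw [tests_append_iff (by simp [Letter.sym]), tests_append_iff (by simp [Letter.sym])]
        exact hev.2 _ _ _ hq
      · rintro q m hq ⟨b, hb, hbs⟩ w
        rw [tests_append_iff (by simp [Letter.sym]), tests_append_iff (by simp [Letter.sym])]
        exact htests q m hq ⟨b, List.mem_cons_of_mem _ hb, hbs⟩ w
    | test q k x Z =>
      by_cases hq : Extend S u N (.pred q k)
      · have hqt := htests q k hq ⟨_, List.mem_cons_self, rfl⟩
        have hc' := hc.snoc_test_snoc_test (m := k) (Z := Z) (Z' := Z)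
          (not_tested_of_free hS.free h e)
          (not_tested_of_subset hS h e h' fun w => (hqt w).2)
          (not_tested_of_subset hS h' e h fun w => (hqt w).1)
          (not_tested_of_free hS.free h' e) (.inl rfl)
        refine ih r (by omega) hc' (h.trans e.steps) (h'.trans e.steps) hγ hy' hu
          ⟨fun f l t hf => ?_, fun q' m w hq' => ?_⟩ honce' ?_
        · rw [creates_append_iff (by simp [Letter.sym]), creates_append_iff (by simp [Letter.sym])]
          exact hev.1 _ _ _ hf
        · by_cases hqq : LSym.pred q k = (LSym.pred q' m : LSym F P L)
          · cases hqq
            have : (fun j => run natState δ (x j)) = fun j => run natState δ' (x j) :=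
              funext fun j => hargs hq' _ ⟨j, rfl⟩
            rw [tests_snoc_iff, tests_snoc_iff, hev.2 _ _ _ hq', this]
          · rw [tests_append_iff (by simpa [Letter.sym] using hqq),
              tests_append_iff (by simpa [Letter.sym] using hqq)]
            exact hev.2 _ _ _ hq'
        · rintro q' m hq' ⟨b, hb, hbs⟩ w
          have hqq : LSym.pred q k ≠ (LSym.pred q' m : LSym F P L) := by
            intro hqq
            exact honce [] q k x Z γ rfl b hb (hbs.trans hqq.symm)
          rw [tests_append_iff (by simpa [Letter.sym] using hqq),
            tests_append_iff (by simpa [Letter.sym] using hqq)]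
          exact htests q' m hq' ⟨b, List.mem_cons_of_mem _ hb, hbs⟩ w
      · -- an irrelevant test: both sides run through the whole statement in their own way
        have hX : (X, K) ∈ S.subs [] := Steps.mem_subs (A := []) h
        have hsym : ∀ s, X.HasSym s → ¬ Extend S u N s := fun s hs hns =>
          hq (ControlClosed.extend.pred_mem hX e hs hns)
        obtain ⟨n₁, n₂, γ₁, γ₂, hn, hγ₁₂, s₁, s₂⟩ := (Steps.letter e hγ).leave (A := [X])
          (fun s hs hns => hsym s (symIn_singleton.1 hs) (.base hns)) hu
        have hpos := s₁.pos_of_nil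
        rw [hγ₁₂] at hy honce htests
        have hy₂ : ∀ a ∈ γ₂, ¬ a.Writes y := fun b hb => hy b (List.mem_append_right _ hb)
        obtain ⟨m, β, hβ, hc'⟩ := hc.exists_execution hS.free [X] h
        obtain ⟨m', β', hβ', hc''⟩ := hc'.symm.exists_execution hS.free [X] h'
        have hβs : ∀ {m : ℕ} {β : List (Letter arF arP V L)}, Steps m [X] β [] →
            ∀ a ∈ β, ¬ Extend S u N a.sym := fun hβ a ha =>
          hsym _ (symIn_singleton.1 (hβ.symIn_of_mem ha))
        have hβy : ∀ {n m : ℕ} {δ β : List (Letter arF arP V L)}, Steps n [S] δ (X :: K) →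
            Steps m [X] β [] → ∀ a ∈ β, ¬ a.Writes y := by
          intro n m δ β h hβ a ha hw
          obtain ⟨β₁, g, k, x, β₂, rfl, -, hg⟩ := exists_flowsInto_of_writes h
            (hβ.append_stack K) ⟨a, ha, hw⟩ s₂ hy₂ hu
          exact hβs hβ (.assign y g k x) (by simp) (.flow hg)
        rw [run_append_of_not_writes hya, run_append_of_not_writes hya,
          ← run_append_of_not_writes (σ := δ) (hβy h hβ),
          ← run_append_of_not_writes (σ := δ') (hβy h' hβ')]
        refine ih n₂ (by omega) hc''.symm (h.trans (hβ.append_stack K))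
          (h'.trans (hβ'.append_stack K)) s₂ hy₂ hu
          (hev.append (fun a ha hn => hβs hβ a ha (.base hn))
            fun a ha hn => hβs hβ' a ha (.base hn)) honce.of_append ?_
        rintro q' k' hq' ⟨b, hb, hbs⟩ w
        rw [tests_append_iff fun a ha e => hβs hβ a ha (e ▸ hq'),
          tests_append_iff fun a ha e => hβs hβ' a ha (e ▸ hq')]
        exact htests q' k' hq' ⟨b, List.mem_append_right _ hb, hbs⟩ w

end Analysis

/-! ### A predicate found by the analysis has an influence -/

section Influence

variable {S X T : Schema arF arP V L} {u y : V} {N : LSym F P L → Prop}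
  {c : PredTerm arF arP V} {δ δ' : List (Letter arF arP V L)}
  {A B C K K' : List (Schema arF arP V L)} {n n' m : ℕ} {s : LSym F P L}

/-- A function symbol of a statement can be made to occur in the execution of this statement, by
choosing outcomes only for the predicates that control it, provided that these outcomes are still
open. -/
theorem exists_execution_visiting (hS : S.Special)
    (hN : ControlClosed S N) {f : F} {l : L} (hf : N (.func f l)) (hδ' : Steps n' [S] δ' C)
    (T : Schema arF arP V L) :
    ∀ {n : ℕ} {δ : List (Letter arF arP V L)} {K : List (Schema arF arP V L)},
      Steps n [S] δ (T :: K) → T.HasSym (.func f l) → Consistent c δ δ' →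
      (∀ q m, N (.pred q m) → T.HasSym (.pred q m) → ∀ w, Tests δ' q m w → Tests δ q m w) →
      ∃ m β, Steps m [T] β [] ∧ (∃ a ∈ β, a.sym = .func f l) ∧ Consistent c (δ ++ β) δ' := by
  induction T with
  | skip =>
    intro n δ K _ hs
    simp at hs
  | assign z g k x =>
    intro n δ K h hs hc _
    obtain h₁ := hasSym_assign.1 hs
    exact ⟨1, _, (Emits.assign z g k x).steps, ⟨_, List.mem_cons_self, h₁.symm⟩,
      hc.snoc_assign z g k x⟩
  | seq T₁ T₂ ih₁ ih₂ =>
    intro n δ K h hs hc ht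
    have h₁ : Steps (n + 1) [S] δ (T₁ :: T₂ :: K) := by
      simpa using h.trans (.seq (.refl (T₁ :: T₂ :: K)))
    rcases hasSym_seq.1 hs with hs | hs
    · obtain ⟨m, β, hβ, ⟨a, ha, has⟩, hc₁⟩ := ih₁ h₁ hs hc fun q m hq hqs =>
        ht q m hq (hasSym_seq.2 (.inl hqs))
      obtain ⟨m', β', hβ', hc₂⟩ := hc₁.exists_execution hS.free [T₂] (K := K)
        (h₁.trans (hβ.append_stack (T₂ :: K)))
      exact ⟨_, β ++ β', .seq ((hβ.append_stack [T₂]).trans hβ'),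
        ⟨a, List.mem_append_left _ ha, has⟩, by simpa using hc₂⟩
    · obtain ⟨m, β, hβ, hc₁⟩ := hc.exists_execution hS.free [T₁] (K := T₂ :: K) h₁
      obtain ⟨m', β', hβ', ⟨a, ha, has⟩, hc₂⟩ := ih₂ (h₁.trans (hβ.append_stack (T₂ :: K))) hs hc₁
        fun q m hq hqs w hw => (ht q m hq (hasSym_seq.2 (.inr hqs)) w hw).append β
      exact ⟨_, β ++ β', .seq ((hβ.append_stack [T₂]).trans hβ'),
        ⟨a, List.mem_append_right _ ha, has⟩, by simpa using hc₂⟩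
  | ite p k x T₁ T₂ ih₁ ih₂ =>
    intro n δ K h hs hc ht
    have hX := Steps.mem_subs (A := []) h
    have hp : N (.pred p k) := hN.pred_mem hX (.iteTrue p k x T₁ T₂) hs hf
    have hnew := not_tested_of_subset hS h (.iteTrue p k x T₁ T₂) hδ'
      (ht p k hp (hasSym_ite.2 (.inl rfl)))
    have hnew' := not_tested_of_free hS.free h (.iteTrue p k x T₁ T₂)
    rcases (hasSym_ite.1 hs).resolve_left (by simp) with hs | hs
    · obtain ⟨m, β, hβ, ⟨a, ha, has⟩, hc₁⟩ := ih₁ (h.trans (Emits.iteTrue p k x T₁ T₂).steps) hs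
        (hc.snoc_test (m := k) hnew' hnew) fun q m hq hqs w hw =>
          (ht q m hq (hasSym_ite.2 (.inr (.inl hqs))) w hw).append _
      exact ⟨_, _, .letter (.iteTrue p k x T₁ T₂) hβ, ⟨a, List.mem_cons_of_mem _ ha, has⟩,
        by simpa using hc₁⟩
    · obtain ⟨m, β, hβ, ⟨a, ha, has⟩, hc₁⟩ := ih₂ (h.trans (Emits.iteFalse p k x T₁ T₂).steps) hs
        (hc.snoc_test (m := k) hnew' hnew) fun q m hq hqs w hw =>
          (ht q m hq (hasSym_ite.2 (.inr (.inr hqs))) w hw).append _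
      exact ⟨_, _, .letter (.iteFalse p k x T₁ T₂) hβ, ⟨a, List.mem_cons_of_mem _ ha, has⟩,
        by simpa using hc₁⟩
  | loop p k x T ih =>
    intro n δ K h hs hc ht
    have hX := Steps.mem_subs (A := []) h
    have hp : N (.pred p k) := hN.pred_mem hX (.loopTrue p k x T) hs hf
    have hnew := not_tested_of_subset hS h (.loopTrue p k x T) hδ'
      (ht p k hp (hasSym_loop.2 (.inl rfl)))
    have hnew' := not_tested_of_free hS.free h (.loopTrue p k x T)
    have h₁ := h.trans (Emits.loopTrue p k x T).steps
    obtain ⟨m, β, hβ, ⟨a, ha, has⟩, hc₁⟩ := ih h₁ ((hasSym_loop.1 hs).resolve_left (by simp))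
      (hc.snoc_test (m := k) hnew' hnew) fun q m hq hqs w hw =>
        (ht q m hq (hasSym_loop.2 (.inr hqs)) w hw).append _
    obtain ⟨m', β', hβ', hc₂⟩ := hc₁.exists_execution hS.free [.loop p k x T] (K := K)
      (h₁.trans (hβ.append_stack (.loop p k x T :: K)))
    exact ⟨_, _, .letter (.loopTrue p k x T) ((hβ.append_stack [.loop p k x T]).trans hβ'),
      ⟨a, List.mem_cons_of_mem _ (List.mem_append_left _ ha), has⟩, by simpa using hc₂⟩

/-- The two parts of a statement contain no assignments of the same function symbol to the same
variable. For a `while` statement, the part after a false test is empty. -/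
theorem Schema.Special.not_writes_same (hS : S.Special) (hX : (X, K) ∈ S.subs []) {p : P} {l : L}
    {x : Fin (arP p) → V} {Z : Bool} (e : Emits X (.test p l x Z) A)
    (e' : Emits X (.test p l x (!Z)) B) {f : F} {k k' : L} (h : SymIn A (.func f k))
    (h' : SymIn B (.func f k')) (hy : S.Assigns f k y) (hy' : S.Assigns f k' y) : False := by
  have h₁ := (controls_of_emits hX e h).resolve_left (by simp)
  have h₂ := (controls_of_emits hX e' h').resolve_left (by simp)
  cases Z with
  | true => exact hS.parts p l f k k' y y h₁ h₂ hy hy' rfl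
  | false => exact hS.parts p l f k' k y y h₂ h₁ hy' hy rfl

theorem Steps.assigns_of_mem (h : Steps n [S] δ C) {f : F} {k : L} {x : Fin (arF f) → V}
    (ha : Letter.assign y f k x ∈ δ) : S.Assigns f k y := by
  obtain ⟨σ₁, σ₂, rfl⟩ := List.append_of_mem ha
  obtain ⟨n₁, n₂, Y, K₁, B, -, h₁, e, -⟩ := h.split_letter
  cases e
  exact assigns_of_mem_subs (Steps.mem_subs (A := []) h₁)

/-- If `c` has no influence through `N`, then two words with the same relevant events cannot reach
a predicate of `Extend S u N` outside `N` in such a way that its outcomes can be chosen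
differently. Otherwise one side could be sent through an assignment to some `y` that flows into
`N`. By liberality and the condition on the two parts of a statement, `y` then differs after the
statement, although that difference can be carried on to a use by `N`. -/
theorem Insensitive.outcomes_not_free (hlab : S.WellLabelled) (hS : S.Special)
    (hN : ControlClosed S N) (hins : Insensitive S u c N) {r : P} {k : L}
    (hr : Extend S u N (.pred r k)) (hnr : ¬ N (.pred r k)) (hc : Consistent c δ δ')
    (h : Steps n [S] δ (X :: K)) (h' : Steps n' [S] δ' (X :: K)) {x : Fin (arP r) → V}
    {Z₀ : Bool} {B₀ : List (Schema arF arP V L)} (e₀ : Emits X (.test r k x Z₀) B₀)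
    (hev : SameEvents (Extend S u N) δ δ')
    (hne : (fun j => run natState δ (x j)) ≠ (fun j => run natState δ' (x j)) ∨
      ((⟨r, fun j => run natState δ (x j)⟩ : PredTerm arF arP V) = c ∧
        (⟨r, fun j => run natState δ' (x j)⟩ : PredTerm arF arP V) = c)) : False := by
  have hX : (X, K) ∈ S.subs [] := Steps.mem_subs (A := []) h
  have hXN : ∀ s, X.HasSym s → ¬ N s := fun s hs hns => hnr (hN.pred_mem hX e₀ hs hns)
  -- an assignment controlled by the predicate whose value flows into `N`
  obtain ⟨f, l, hfl, Z, hctrl⟩ : ∃ f l, FlowsInto S u N f l ∧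
      ∃ Z, S.Controls r k Z (.func f l) := by
    rcases hr.exists_flowsInto hlab hN with h | ⟨f, l, hf, h | ⟨q, m, Z, h, hc⟩⟩
    · exact (hnr h).elim
    · cases h
    · cases h
      exact ⟨f, l, hf, Z, hc⟩
  have hEfl : Extend S u N (.func f l) := .flow hfl
  obtain ⟨X', K', x', T, tail, hX', e, hT⟩ := exists_emits_of_controls hctrl []
  obtain ⟨rfl, rfl⟩ := eq_of_sym_eq hlab hX hX' e₀ e rfl
  obtain rfl := e₀.test_args_eq e
  obtain ⟨B', e'⟩ := e.flip (!Z)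
  obtain ⟨y, x₀, n₀, σ₀, m₀, γ₀, K₀, C, hs₀, hγ₀, hy₀, hu⟩ := hfl
  -- from the exit of the statement, `y` can be carried on to its use
  obtain ⟨k₁, ρ, Y, A, a, D, hρ, ea, ha⟩ := exists_steps_of_hasSym hT
  have hstart := (h.trans e.steps).trans (hρ.append_stack (tail ++ K))
  obtain ⟨hY, hK₀⟩ := hstart.head_unique hlab hs₀ ea (.assign y f l x₀) ha
  obtain rfl : A ++ (tail ++ K) = K₀ := hK₀
  obtain ⟨r₁, γ₁, hγ₁⟩ : ∃ r₁ γ₁, IsShortest y r₁ K γ₁ C := by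
    rw [← List.append_assoc] at hγ₀
    obtain ⟨n₁, n₂, τ₁, τ₂, -, rfl, -, s₂⟩ := hγ₀.leave (fun s hs => hXN s <| by
      obtain ⟨W, hW, hs⟩ := hs
      rcases List.mem_append.1 hW with hW | hW
      · exact e.hasSym_of_symIn ⟨T, List.mem_cons_self,
          symIn_singleton.1 (hρ.symIn ⟨W, List.mem_cons_of_mem _ hW, hs⟩)⟩
      · exact e.hasSym_of_symIn ⟨W, List.mem_cons_of_mem _ hW, hs⟩) hu
    exact exists_isShortest s₂ fun a ha => hy₀ a (List.mem_append_right _ ha)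
  have hflow : ∀ {n m : ℕ} {δ β : List (Letter arF arP V L)} {A : List (Schema arF arP V L)},
      Steps n [S] δ A → Steps m A β K → (∃ a ∈ β, a.Writes y) → ∃ β₁ g j z β₂,
        β = β₁ ++ Letter.assign y g j z :: β₂ ∧ (∀ a ∈ β₂, ¬ a.Writes y) ∧
          FlowsInto S u N g j :=
    fun h hβ hw => exists_flowsInto_of_writes h hβ hw hγ₁.1 hγ₁.2.1 hu
  -- the test can be given opposite outcomes on the two sides
  have hrt := fun w => hev.2 r k w hr
  have hc₁ := hc.snoc_test_snoc_test (m := k) (Z := Z) (Z' := !Z)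
    (not_tested_of_free hS.free h e₀) (not_tested_of_subset hS h e₀ h' fun w => (hrt w).2)
    (not_tested_of_subset hS h' e₀ h fun w => (hrt w).1) (not_tested_of_free hS.free h' e₀)
    (.inr hne)
  have h₁ := h.trans e.steps
  have h₁' := h'.trans e'.steps
  -- one side visits the assignment, the other one runs through the opposite part
  obtain ⟨m₁, β, hβ, ⟨b, hb, hbs⟩, hc₂⟩ := exists_execution_visiting hS ControlClosed.extend hEfl
    h₁' T (K := tail ++ K) h₁ hT hc₁ (fun q m hq hqs w hw => by
      have hqr : (LSym.pred r k : LSym F P L) ≠ .pred q m := by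
        intro hqr
        rw [← hqr] at hqs
        exact not_hasSym_of_emits (wellLabelled_of_mem_subs hlab hX) e hqs
      rw [tests_append_iff (by simpa [Letter.sym] using hqr)] at hw ⊢
      exact (hev.2 q m w hq).2 hw)
  have h₂ := h₁.trans (hβ.append_stack (tail ++ K))
  obtain ⟨m₂, ε, hε, hc₃⟩ := hc₂.exists_execution hS.free tail h₂
  have h₃ := h₂.trans (hε.append_stack K)
  obtain ⟨m₃, β', hβ', hc₄⟩ := hc₃.symm.exists_execution hS.free B' h₁'
  have h₃' := h₁'.trans (hβ'.append_stack K)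
  simp only [List.nil_append] at h₃ h₃'
  have hβε : Steps (m₁ + m₂) (T :: tail) (β ++ ε) [] := (hβ.append_stack tail).trans hε
  have hXβ : ∀ a ∈ [Letter.test r k x Z] ++ (β ++ ε), X.HasSym a.sym := by
    intro a ha
    rcases List.mem_append.1 ha with ha | ha
    · obtain rfl := List.mem_singleton.1 ha
      exact e.hasSym
    · exact e.hasSym_of_symIn (hβε.symIn_of_mem ha)
  have hXβ' : ∀ a ∈ [Letter.test r k x (!Z)] ++ β', X.HasSym a.sym := by
    intro a ha
    rcases List.mem_append.1 ha with ha | ha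
    · obtain rfl := List.mem_singleton.1 ha
      exact e'.hasSym
    · exact e'.hasSym_of_symIn (hβ'.symIn_of_mem ha)
  have hout := hγ₁.not_hasSym hlab h ((Steps.letter e (K := []) (by simpa using hβε))) hXN hu
  -- the values of `y` agree at the exit, since they are about to be used
  have heq := eq_of_insensitive (y := y) hS hins r₁ hc₄.symm h₃ h₃' hγ₁.1 hγ₁.2.1 hu
    (by
      have := (hev.mono fun s => Extend.base).append (fun a ha => hXN _ (hXβ a ha))
        (fun a ha => hXN _ (hXβ' a ha))
      simpa using this)
    (hγ₁.testsOnce hlab h₃)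
    (by
      rintro q m hq ⟨a, ha, has⟩ w
      have hXq : ¬ X.HasSym (.pred q m) := has ▸ hout a ha
      have t₁ := tests_append_iff (δ := δ) (w := w) fun a ha e => hXq (e ▸ hXβ a ha)
      have t₂ := tests_append_iff (δ := δ') (w := w) fun a ha e => hXq (e ▸ hXβ' a ha)
      simp only [List.append_assoc] at t₁ t₂ ⊢
      rw [t₁, t₂]
      exact hev.2 q m w hq)
  -- but the last assignments to `y` on the two sides create different terms
  have hwrite : ∃ a ∈ β ++ ε, a.Writes y := by
    refine ⟨b, List.mem_append_left _ hb, ?_⟩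
    obtain ⟨b₁, b₂, rfl⟩ := List.append_of_mem hb
    obtain ⟨n₁, n₂, W, K₁, D₁, -, s₁, eW, -⟩ := hβ.split_letter
    obtain ⟨rfl, -⟩ := (h₁.trans (s₁.append_stack (tail ++ K))).head_unique hlab hs₀ eW
      (.assign y f l x₀) hbs
    cases eW
    rfl
  obtain ⟨a₁, g, j, z, a₂, hsplit, ha₂, -⟩ := hflow h₁ (by
    simpa using hβε.append_stack K) hwrite
  have hword : δ ++ [Letter.test r k x Z] ++ β ++ ε =
      δ ++ [Letter.test r k x Z] ++ a₁ ++ Letter.assign y g j z :: a₂ := by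
    rw [List.append_assoc _ β ε, hsplit]
    simp
  rw [hword] at h₃ heq
  rw [run_last_write ha₂] at heq
  obtain ⟨n₁, n₂, W, K₁, D₁, -, s₁, eW, -⟩ := h₃.split_letter
  cases eW
  by_cases hw' : ∃ a ∈ δ' ++ [Letter.test r k x (!Z)] ++ β', a.Writes y
  · obtain ⟨c₁, g', j', z', c₂, hδ', hc₂', hflow'⟩ := hflow (.refl [S]) h₃' hw'
    rw [hδ', run_last_write hc₂'] at heq
    obtain rfl := (Term.app.inj heq).1
    have hargs := eq_of_heq (Term.app.inj heq).2
    rw [List.append_assoc] at hδ'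
    rcases exists_eq_of_append_cons_eq_append hδ' with ⟨d, rfl⟩ | ⟨d, hd, -⟩
    · have hcr : Creates δ g j' fun i => run natState c₁ (z' i) :=
        (hev.1 g j' _ (.flow hflow')).2 ⟨c₁, y, z', d, rfl, rfl⟩
      rw [← hargs] at hcr
      exact not_creates_of_liberal hS.free hS.liberal s₁ ((hcr.append _).append _)
    · cases d with
      | nil => cases hd
      | cons d₀ d =>
        obtain ⟨rfl, rfl⟩ := List.cons.inj hd
        exact hS.not_writes_same (y := y) hX e e'
          (hβε.symIn_of_mem (a := .assign y g j z) (by rw [hsplit]; simp))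
          (hβ'.symIn_of_mem (a := .assign y g j' z') (by simp))
          (h₃.assigns_of_mem (x := z) (by simp)) (h₃'.assigns_of_mem (x := z') (by simp))
  · rw [run_of_not_writes fun a ha hwa => hw' ⟨a, ha, hwa⟩] at heq
    cases heq

/-- If `c` has no influence through `N`, it has none through the next stage of the analysis. -/
theorem Insensitive.extend (hlab : S.WellLabelled) (hS : S.Special) (hN : ControlClosed S N)
    (hins : Insensitive S u c N) : Insensitive S u c (Extend S u N) := by
  intro δ δ' n n' C y hc h h' hev hu
  have hevN : SameEvents N δ δ' := hev.mono fun s => Extend.base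
  cases C with
  | nil => exact hins hc h h' hevN hu
  | cons X K =>
    obtain ⟨a, B, e, ha, hr⟩ := hu
    by_cases haN : N a.sym
    · exact hins hc h h' hevN ⟨a, B, e, haN, hr⟩
    cases a with
    | test q m x Z =>
      obtain ⟨k, rfl⟩ := hr
      by_contra hne
      exact hins.outcomes_not_free hlab hS hN ha haN hc h h' e hev
        (.inl fun heq => hne (congrFun heq k))
    | assign z g m x =>
      obtain ⟨k, rfl⟩ := hr
      obtain ⟨y, x₀, n₀, σ₀, m₀, γ₀, K₀, C, hs₀, hγ₀, hy₀, hu⟩ : FlowsInto S u N g m := by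
        rcases ha.exists_flowsInto hlab hN with h | ⟨f, l, hf, h | ⟨q, m, Z, h, -⟩⟩
        · exact (haN h).elim
        · cases h
          exact hf
        · cases h
      obtain ⟨rfl, rfl⟩ := h.head_unique hlab hs₀ e (.assign y g m x₀) rfl
      cases e
      obtain ⟨r, γ, hγ⟩ := exists_isShortest hγ₀ hy₀
      have h₁ := h.trans (Emits.assign z g m x).steps
      have h₁' := h'.trans (Emits.assign z g m x).steps
      have heq := eq_of_insensitive (y := z) hS hins r
        ((hc.snoc_assign z g m x).symm.snoc_assign z g m x).symm h₁ h₁' hγ.1 hγ.2.1 hu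
        (hevN.append (by simpa using haN) (by simpa using haN)) (hγ.testsOnce hlab h₁)
        (by
          intro q k hq _ w
          rw [tests_append_iff (by simp [Letter.sym]), tests_append_iff (by simp [Letter.sym])]
          exact hev.2 q k w hq)
      rw [run_last_write (τ := []) (by simp), run_last_write (τ := []) (by simp)] at heq
      exact congrFun (eq_of_heq (Term.app.inj heq).2) k

theorem finite_tested (δ : List (Letter arF arP V L)) : {a | Tested δ a}.Finite := by
  induction δ using List.reverseRecOn with
  | nil =>
    refine Set.finite_empty.subset ?_
    rintro a ⟨m, σ₁, x, Z, σ₂, h, -⟩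
    simp at h
  | append_singleton δ b ih =>
    cases b with
    | assign y f l x =>
      refine ih.subset ?_
      rintro a ⟨m, hm⟩
      exact ⟨m, (tests_append_iff (by simp [Letter.sym])).1 hm⟩
    | test q k x Z =>
      refine (ih.insert ⟨q, fun j => run natState δ (x j)⟩).subset ?_
      rintro ⟨p, w⟩ ⟨m, hm⟩
      by_cases hqp : (LSym.pred q k : LSym F P L) = .pred p m
      · cases hqp
        rcases tests_snoc_iff.1 hm with hm | rfl
        · exact .inr ⟨_, hm⟩
        · exact .inl rfl
      · exact .inr ⟨m, (tests_append_iff (by simpa [Letter.sym] using hqp)).1 hm⟩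

/-- Restricting an interpretation to the predicate terms tested along `δ` leaves finitely many true
ones. -/
theorem Consistent.refl (hF : S.Free) (c : PredTerm arF arP V) (h : Steps n [S] δ C) :
    Consistent c δ δ := by
  classical
  obtain ⟨i, -, hi⟩ := hF δ h.begins
  have hfin : {a | (if Tested δ a then i a else false) = true}.Finite :=
    (finite_tested δ).subset fun a ha => by
      by_contra hna
      have hna : ¬ Tested δ a := hna
      simp [hna] at ha
  have ha : Agrees (fun a => if Tested δ a then i a else false) natState δ :=
    hi.congr fun a ha => by simp [ha]
  exact ⟨_, _, hfin, hfin, fun _ _ => rfl, ha, ha⟩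

/-- Without a couple at `c`, the value of `c` has no influence on the final value of `u`. -/
theorem insensitive_of_forall_not_isCouple {p : P} {t : Fin (arP p) → Term arF V}
    (h : ∀ i j, ¬ S.IsCouple p t u i j) : Insensitive S u ⟨p, t⟩ fun _ => False := by
  intro δ δ' n n' C y hc hδ hδ' _ hu
  cases C with
  | cons X K =>
    obtain ⟨_, _, _, hf, _⟩ := hu
    exact hf.elim
  | nil =>
    obtain rfl : y = u := hu
    obtain ⟨i, i', -, -, heq, ha, ha'⟩ := hc
    by_cases hii : i ⟨p, t⟩ = i' ⟨p, t⟩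
    · obtain rfl : i = i' := funext fun a => by
        by_cases hac : a = ⟨p, t⟩
        · rw [hac, hii]
        · exact heq a hac
      rw [S.paths_unique i natState δ δ' hδ.mem_paths hδ'.mem_paths ha ha']
    · by_contra hne
      exact h i i' ⟨hii, heq, _, _, Schema.final_eq_some_iff.2 ⟨δ, hδ.mem_paths, ha, rfl⟩,
        Schema.final_eq_some_iff.2 ⟨δ', hδ'.mem_paths, ha', rfl⟩, hne⟩

end Influence

/-! ### The set `need(u)` and the analysis -/

section Need

variable {S X : Schema arF arP V L} {u : V} {f : F} {l : L} {N : LSym F P L → Prop}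

/-- A path of `S` that contains an assignment, cut into the part before it and two parts `γ` and `ν`
after it, as runs between program points. -/
theorem exists_steps_of_segment {μ γ ν : List (Letter arF arP V L)} {y : V}
    {x : Fin (arF f) → V} (h : μ ++ Letter.assign y f l x :: (γ ++ ν) ∈ S.paths) :
    ∃ n m r K C, Steps n [S] μ (.assign y f l x :: K) ∧ Steps m K γ C ∧ Steps r C ν [] := by
  obtain ⟨n, hn⟩ := exists_steps_of_mem_paths S h []
  obtain ⟨n₁, n₂, Y, K, B, -, h₁, e, h₂⟩ := hn.split_letter
  cases e
  cases ν with
  | nil => exact ⟨n₁, n₂, 0, K, [], h₁, by simpa using h₂, .refl _⟩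
  | cons a ν =>
    obtain ⟨n₃, n₄, X, K', B, -, h₃, e, h₄⟩ := h₂.split_letter
    exact ⟨n₁, n₃, _, K, X :: K', h₁, h₃, .letter e h₄⟩

theorem Schema.FinalDep.flowsInto (h : S.FinalDep f l u) : FlowsInto S u N f l := by
  obtain ⟨σ, ⟨μ, hμ⟩, ts, hts⟩ := h
  obtain ⟨σ₁, x, σ₂, rfl, hy, -⟩ := labelledRun_eq_app hts
  rw [← List.append_assoc, ← List.append_nil σ₂] at hμ
  obtain ⟨n, m, r, K, C, h₁, h₂, h₃⟩ := exists_steps_of_segment hμ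
  refine ⟨u, x, n, _, _, σ₂, K, [], h₁, by simpa using h₂.trans h₃, hy, rfl⟩

theorem Schema.DataDep.flowsInto {s : LSym F P L} (h : S.DataDep f l s) (hs : N s) :
    FlowsInto S u N f l := by
  cases s with
  | func g m =>
    obtain ⟨σ, ⟨μ, ν, hσ⟩, v, ts, hts, k, ts', hk⟩ := h
    obtain ⟨σ₁, x, σ₂, rfl, -, rfl⟩ := labelledRun_eq_app hts
    obtain ⟨σ₃, x', γ, rfl, hy, -⟩ := labelledRun_eq_app hk
    have hσ' : (μ ++ σ₃) ++ Letter.assign (x k) f l x' ::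
        (γ ++ Letter.assign v g m x :: (σ₂ ++ ν)) ∈ S.paths := by simpa using hσ
    obtain ⟨n, r, q, K, C, h₁, h₂, h₃⟩ := exists_steps_of_segment hσ'
    obtain ⟨r₁, r₂, X, K', B, -, h₄, e, -⟩ := Steps.split_letter (σ := []) h₃
    exact ⟨x k, x', n, _, _, γ, K, X :: K', h₁, by simpa using h₂.trans h₄, hy,
      _, B, e, hs, k, rfl⟩
  | pred p m =>
    obtain ⟨σ, x, Z, ⟨μ, ν, hσ⟩, k, ts, hk⟩ := h
    obtain ⟨σ₃, x', γ, rfl, hy, -⟩ := labelledRun_eq_app hk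
    have hσ' : (μ ++ σ₃) ++ Letter.assign (x k) f l x' ::
        (γ ++ Letter.test p m x Z :: ν) ∈ S.paths := by simpa using hσ
    obtain ⟨n, r, q, K, C, h₁, h₂, h₃⟩ := exists_steps_of_segment hσ'
    obtain ⟨r₁, r₂, X, K', B, -, h₄, e, -⟩ := Steps.split_letter (σ := []) h₃
    exact ⟨x k, x', n, _, _, γ, K, X :: K', h₁, by simpa using h₂.trans h₄, hy,
      _, B, e, hs, k, rfl⟩

theorem Schema.Need.needUpTo {s : LSym F P L} (h : S.Need u s) : ∃ n, NeedUpTo S u n s := by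
  induction h with
  | final f l h => exact ⟨1, .flow h.flowsInto⟩
  | data f l s _ hd ih =>
    obtain ⟨n, hn⟩ := ih
    exact ⟨n + 1, .flow (hd.flowsInto hn)⟩
  | control p l Z s _ hc ih =>
    obtain ⟨n, hn⟩ := ih
    exact ⟨n + 1, .control (.base hn) hc⟩

/-- Wherever a path leads to a test of a predicate in `need(u)`, there is a couple for the
predicate term tested there. -/
theorem Schema.Need.exists_isCouple (hlab : S.WellLabelled) (hS : S.Special) {p : P} {l : L}
    (h : S.Need u (.pred p l)) {n : ℕ} {δ : List (Letter arF arP V L)}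
    {K B : List (Schema arF arP V L)} (hδ : Steps n [S] δ (X :: K)) {x : Fin (arP p) → V}
    {Z : Bool} (e : Emits X (.test p l x Z) B) :
    ∃ i j, S.IsCouple p (fun k => run natState δ (x k)) u i j := by
  by_contra! hno
  have key : ∀ n, ControlClosed S (NeedUpTo S u n) ∧
      Insensitive S u ⟨p, fun k => run natState δ (x k)⟩ (NeedUpTo S u n) ∧
        ¬ NeedUpTo S u n (.pred p l) := by
    intro n
    induction n with
    | zero => exact ⟨fun _ _ _ _ h => h.elim, insensitive_of_forall_not_isCouple hno, id⟩
    | succ n ih =>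
      obtain ⟨hN, hins, hp⟩ := ih
      refine ⟨ControlClosed.extend, hins.extend hlab hS hN, fun hp' => ?_⟩
      exact hins.outcomes_not_free hlab hS hN hp' hp (Consistent.refl hS.free _ hδ) hδ hδ e
        ⟨fun _ _ _ _ => Iff.rfl, fun _ _ _ _ => Iff.rfl⟩ (.inr ⟨rfl, rfl⟩)
  obtain ⟨n, hn⟩ := h.needUpTo
  exact (key n).2.2 hn

/-- The symbols contained in a term created by a function symbol in `need(u)` can be carried on
to the final value of `u`, or to a test of a predicate in `need(u)`. -/
theorem Schema.Need.exists_contains (hlab : S.WellLabelled) {s : LSym F P L} (h : S.Need u s) :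
    ∀ {f : F} {l : L} {n : ℕ} {σ : List (Letter arF arP V L)} {y : V} {x : Fin (arF f) → V}
      {K : List (Schema arF arP V L)} {g : F}, s = .func f l →
      Steps n [S] σ (.assign y f l x :: K) →
      (Term.app f fun k => run natState σ (x k)).Contains g →
      ∃ m δ z C, Steps m [S] δ C ∧ Uses u (fun s => S.Need u s ∧ ∃ p k, s = .pred p k) z C ∧
        (run natState δ z).Contains g := by
  have carry : ∀ {N : LSym F P L → Prop} {f : F} {l : L} {n : ℕ}
      {σ : List (Letter arF arP V L)} {y : V} {x : Fin (arF f) → V}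
      {K : List (Schema arF arP V L)} {g : F}, FlowsInto S u N f l →
      Steps n [S] σ (.assign y f l x :: K) →
      (Term.app f fun k => run natState σ (x k)).Contains g →
      ∃ m δ C, Steps m [S] δ C ∧ Uses u N y C ∧ (run natState δ y).Contains g := by
    intro N f l n σ y x K g hf hσ hg
    obtain ⟨y', x', n', σ', m, γ, K', C, hσ', hγ, hy, hu⟩ := hf
    obtain ⟨hX, rfl⟩ := hσ.head_unique hlab hσ' (.assign y f l x) (.assign y' f l x') rfl
    obtain ⟨rfl, -⟩ := Schema.assign.inj hX
    refine ⟨_, _, C, (hσ.trans (Emits.assign y f l x).steps).trans hγ, hu, ?_⟩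
    rw [List.append_assoc, List.singleton_append, run_last_write hy]
    exact hg
  induction h with
  | final f₀ l₀ hd =>
    rintro f l n σ y x K g ⟨⟩ hσ hg
    obtain ⟨m, δ, C, hδ, hu, hc⟩ := carry (N := fun _ => False) hd.flowsInto hσ hg
    exact ⟨m, δ, y, C, hδ, hu.mono fun _ h => h.elim, hc⟩
  | data f₀ l₀ s hs hd ih =>
    rintro f l n σ y x K g ⟨⟩ hσ hg
    obtain ⟨m, δ, C, hδ, hu, hc⟩ := carry (N := fun s' => s' = s) (hd.flowsInto rfl) hσ hg
    cases C with
    | nil => exact ⟨m, δ, y, [], hδ, hu, hc⟩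
    | cons X K' =>
      obtain ⟨a, B, e, rfl, hr⟩ := hu
      cases a with
      | test p k x' Z => exact ⟨m, δ, y, _, hδ, ⟨_, B, e, ⟨hs, p, k, rfl⟩, hr⟩, hc⟩
      | assign v g' k x' =>
        cases e
        obtain ⟨j, rfl⟩ := hr
        exact ih rfl hδ (.inr ⟨j, hc⟩)
  | control p l Z s _ _ _ =>
    rintro f l n σ y x K g ⟨⟩

theorem Schema.Need.exists_steps (h : S.Need u (.func f l)) :
    ∃ n σ y x K, Steps n [S] σ (.assign y f l x :: K) := by
  have H : FlowsInto S u (fun _ => True) f l := by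
    cases h with
    | final _ _ hd => exact hd.flowsInto
    | data _ _ s _ hd => exact hd.flowsInto trivial
  obtain ⟨y, x, n, σ, _, _, K, _, hσ, -⟩ := H
  exact ⟨n, σ, y, x, K, hσ⟩

end Need

end SchemaTheory

theorem theorem8p4 {F P V L : Type*} (arF : F → ℕ) (arP : P → ℕ)
    (S : Schema arF arP V L) (hlab : S.WellLabelled) (hS : S.Special) (u : V) :
    (∀ (p : P) (l : L), S.Need u (.pred p l) →
      ∃ (t : Fin (arP p) → Term arF V) (i j : Herbrand arF arP V), S.IsCouple p t u i j) ∧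
    (∀ (f : F) (l : L), S.Need u (.func f l) →
      (∃ (i : Herbrand arF arP V) (d : State arF V),
        S.final i natState = some d ∧ (d u).Contains f) ∨
      (∃ (p : P) (m : L) (t : Fin (arP p) → Term arF V) (i j : Herbrand arF arP V),
        S.Need u (.pred p m) ∧ S.IsCouple p t u i j ∧ ∃ k, (t k).Contains f)) := by
  refine ⟨fun p l h => ?_, fun f l h => ?_⟩
  · cases h with
    | control _ _ Z s hs hc =>
      obtain ⟨X, K, x, T, B, hm, e, -⟩ := exists_emits_of_controls hc []
      obtain ⟨n, δ, hδ⟩ := exists_steps_of_mem_subs hm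
      exact ⟨_, (Schema.Need.control p l Z s hs hc).exists_isCouple hlab hS hδ e⟩
  · obtain ⟨n, σ, y, x, K, hσ⟩ := h.exists_steps
    obtain ⟨m, δ, z, C, hδ, hu, hc⟩ := h.exists_contains hlab rfl hσ (g := f) (.inl rfl)
    cases C with
    | nil =>
      obtain rfl : z = u := hu
      obtain ⟨i, -, hi⟩ := hS.free δ hδ.begins
      exact .inl ⟨i, _, Schema.final_eq_some_iff.2 ⟨δ, hδ.mem_paths, hi, rfl⟩, hc⟩
    | cons X K =>
      obtain ⟨a, B, e, ⟨hn, p, k, hp⟩, hr⟩ := hu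
      cases a with
      | assign _ _ _ _ => cases hp
      | test q k' x' Z =>
        obtain ⟨j, rfl⟩ := hr
        obtain ⟨i, i', hii⟩ := hn.exists_isCouple hlab hS hδ e
        exact .inr ⟨q, k', _, i, i', hn, hii, j, hc⟩
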